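/- Let $M$ and $N$ be nonempty smooth closed manifolds (compact, Hausdorff, without boundary, not necessarily connected) of the same dimension $n\ge 1$. For $\mu,\nu$ Borel probability measures on $M$ and $N$, let $\Pi(\mu,\nu)$ be the set of nonnegative Borel measures on $M\times N$ with marginals $\mu$ and $\nu$; for a continuous cost $c:M\times N\to\mathbf R$, a plan $\gamma\in\Pi(\mu,\nu)$ is optimal if it minimizes $\int_{M\times N} c\,d\gamma$ over $\Pi(\mu,\nu)$. Monge's problem is to minimize $\int_M c(x,T(x))\,d\mu(x)$ over all measurable maps $T:M\to N$ with $T_\sharp\mu=\nu$. For $c$ of class $C^2$, let $\frac{\partial^2 c}{\partial x\partial y}(\bar x,\bar y):T_{\bar y}N\to (T_{\bar x}M)^*$ denote the differential at $\bar y$ of $y\mapsto \frac{\partial c}{\partial x}(\bar x,y)$, and consider the condition $$(\ast)\qquad \exists\,(\bar x,\bar y)\in M\times N\ \text{ such that }\ \frac{\partial^2 c}{\partial x\,\partial y}(\bar x,\bar y)\ \text{ is invertible.}$$ **Theorem 1.1 (Non-genericity of twist).** 1. Let $c:M\times N\to\mathbf R$ be of class $C^2$ and satisfy $(\ast)$.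 Then there are probability measures $\mu$ on $M$ and $\nu$ on $N$, both absolutely continuous with respect to Lebesgue measure (i.e. giving mass zero to every set whose image in every smooth chart is Lebesgue-null), for which there is a unique optimal plan $\gamma$, and $\gamma$ is not supported on a graph: there is no map $T:M\to N$ with $y=T(x)$ for $\gamma$-almost every $(x,y)$. Moreover, Monge's problem for $c,\mu,\nu$ has no solution: no transport map attains the infimum. 2. The set of costs $c\in C^2(M\times N;\mathbf R)$ satisfying $(\ast)$ is open and dense in $C^2(M\times N;\mathbf R)$ for the $C^2$ topology (uniform convergence, on compact subsets of smooth charts, of the coordinate expressions together with their derivatives of order at most $2$). -/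

import Mathlib

open MeasureTheory
open scoped Manifold ContDiff Topology

noncomputable section

/-- The `C^k` topology on `C^k(X; ℝ)`, for a smooth manifold `X`: the coarsest topology for which, in
every smooth chart of `X` and for every `j ≤ k`, the `j`-th derivative of the coordinate expression
of `f` depends continuously on `f` for uniform convergence on compact subsets of the chart domain.
(For compact `X` the weak and the strong Whitney topologies coincide, and are this topology.) -/
@[reducible] def ckTopology {E H : Type*} [NormedAddCommGroup E] [NormedSpace ℝ E] [TopologicalSpace H]
    (I : ModelWithCorners ℝ E H) (X : Type*) [TopologicalSpace X] [ChartedSpace H X] (k : ℕ) :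
    TopologicalSpace (ContMDiffMap I 𝓘(ℝ, ℝ) X ℝ k) :=
  ⨅ e ∈ IsManifold.maximalAtlas I ∞ X, ⨅ j ∈ Set.Iic k,
    TopologicalSpace.induced
      (fun f => UniformOnFun.ofFun {K : Set E | IsCompact K ∧ K ⊆ (e.extend I).target}
        (iteratedFDeriv ℝ j (fun u => f ((e.extend I).symm u))))
      inferInstance

/-- `A` is Lebesgue-null in the `n`-manifold `X`: its image in every smooth chart is Lebesgue-null
in `ℝⁿ`. -/
def LebesgueNull (n : ℕ) {X : Type*} [TopologicalSpace X]
    [ChartedSpace (EuclideanSpace ℝ (Fin n)) X] (A : Set X) : Prop :=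
  ∀ e ∈ IsManifold.maximalAtlas (𝓡 n) ∞ X, volume (e '' (e.source ∩ A)) = 0

/-- `μ` is absolutely continuous with respect to the Lebesgue measure (class) of the `n`-manifold
`X`. -/
def IsLebesgueAC (n : ℕ) {X : Type*} [TopologicalSpace X]
    [ChartedSpace (EuclideanSpace ℝ (Fin n)) X] [MeasurableSpace X] (μ : Measure X) : Prop :=
  ∀ A : Set X, LebesgueNull n A → μ A = 0

section Cost

variable {M N : Type*}

/-- The partial differential `∂c/∂x (x, y)`, an element of the dual of
`T_x M = EuclideanSpace ℝ (Fin n)`. -/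
def partialX (n : ℕ) [TopologicalSpace M] [ChartedSpace (EuclideanSpace ℝ (Fin n)) M]
    (c : M × N → ℝ) (x : M) (y : N) : EuclideanSpace ℝ (Fin n) →L[ℝ] ℝ :=
  mfderiv (𝓡 n) 𝓘(ℝ, ℝ) (fun x' => c (x', y)) x

/-- The mixed second derivative `∂²c/∂x∂y (x, y) : T_y N → (T_x M)*`: the differential at `y` of
`y' ↦ ∂c/∂x (x, y')`, a map from `N` to the fixed vector space `(T_x M)*`. -/
def mixedHessian (n : ℕ) [TopologicalSpace M] [ChartedSpace (EuclideanSpace ℝ (Fin n)) M]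
    [TopologicalSpace N] [ChartedSpace (EuclideanSpace ℝ (Fin n)) N]
    (c : M × N → ℝ) (x : M) (y : N) :
    EuclideanSpace ℝ (Fin n) →L[ℝ] (EuclideanSpace ℝ (Fin n) →L[ℝ] ℝ) :=
  mfderiv (𝓡 n) 𝓘(ℝ, EuclideanSpace ℝ (Fin n) →L[ℝ] ℝ) (fun y' => partialX n c x y') y

/-- The mixed second derivative of `c` is invertible at some point of `M × N`. -/
def HasInvertibleMixedHessian (n : ℕ)
    [TopologicalSpace M] [ChartedSpace (EuclideanSpace ℝ (Fin n)) M]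
    [TopologicalSpace N] [ChartedSpace (EuclideanSpace ℝ (Fin n)) N] (c : M × N → ℝ) : Prop :=
  ∃ (x : M) (y : N), Function.Bijective (mixedHessian n c x y)

variable [MeasurableSpace M] [MeasurableSpace N]

/-- `γ ∈ Π(μ, ν)`: `γ` is a nonnegative measure on `M × N` with marginals `μ` and `ν`. -/
def IsTransportPlan (μ : Measure M) (ν : Measure N) (γ : Measure (M × N)) : Prop :=
  γ.map Prod.fst = μ ∧ γ.map Prod.snd = ν

/-- `γ` minimizes the Kantorovich cost among all transport plans between `μ` and `ν`. -/
def IsOptimalPlan (c : M × N → ℝ) (μ : Measure M) (ν : Measure N) (γ : Measure (M × N)) : Prop :=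
  IsTransportPlan μ ν γ ∧ ∀ γ' : Measure (M × N), IsTransportPlan μ ν γ' →
    ∫ p, c p ∂γ ≤ ∫ p, c p ∂γ'

/-- `γ` is concentrated on the graph of some map `M → N` (which need not be measurable). -/
def IsSupportedOnGraph (γ : Measure (M × N)) : Prop :=
  ∃ T : M → N, ∀ᵐ p ∂γ, p.2 = T p.1

/-- `T` is a transport map from `μ` to `ν`. -/
def IsTransportMap (μ : Measure M) (ν : Measure N) (T : M → N) : Prop :=
  Measurable T ∧ μ.map T = ν

/-- `T` solves the Monge problem: it minimizes the transportation cost among all transport maps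
from `μ` to `ν`. -/
def IsMongeSolution (c : M × N → ℝ) (μ : Measure M) (ν : Measure N) (T : M → N) : Prop :=
  IsTransportMap μ ν T ∧ ∀ T' : M → N, IsTransportMap μ ν T' →
    ∫ x, c (x, T x) ∂μ ≤ ∫ x, c (x, T' x) ∂μ

end Cost

end

/-!
The twist condition asks that `y ↦ ∂c/∂x (x, y)` be injective for every `x`. On closed manifolds it
fails as soon as one mixed Hessian is invertible, for a topological reason: a map `f` of class `C¹`
from a closed `n`-manifold to `ℝⁿ` has degree zero modulo two, so almost every value is taken an even
number of times (`ae_even_ncard_preimage`). If `f` is a local diffeomorphism at some point, its image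
has positive measure, and a regular value in it is taken at two distinct points
(`exists_ne_map_eq_of_bijective_mfderiv`). Applied to `f = ∂c/∂x (x₀, ·)`, this gives `y₁ ≠ y₂` with
`∂c/∂x (x₀, y₁) = ∂c/∂x (x₀, y₂) = p`, both with invertible mixed Hessian (`exists_ne_partialX_eq`).

The parity statement rests on an integral. The Jacobian determinant of a compactly supported
self-map of `ℝⁿ` integrates to zero (`integral_det_fderiv_eq_zero`); if `Φ` is a map whose Jacobian
determinant is a bump function at `p`, then the integral of `det D(Φ ∘ F)` counts the preimages of `p`
under `F` with signs. Hence the parity of the number of preimages does not change when `F` is modified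
in a compact subset of a chart (`even_card_sub_card`), and finitely many such modifications turn a
map on a closed manifold into `0`.

Non-uniqueness of the target is turned into an optimal plan by duality. In a chart at `x₀`, take the
potential `w ξ = p ξ - K ‖ξ - ξ₀‖ ^ 2`, where `K` is large. The equation `∂c/∂x (ξ, y) = Dw ξ` has a
solution `y` near each of `y₁` and `y₂`, depending continuously on `ξ`, and since `w` is so concave,
`c (·, y) - w` has a strict minimum at `ξ` (`exists_localPotential`). The plan which spreads the
uniform measure of a small cube and sends half of the mass at each point to either solution is
therefore optimal and unique, by the equality case of the easy half of Kantorovich duality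
(`IsTransportPlan.le_integral_and_eq`), and it is not carried by a graph. The second marginal is
absolutely continuous because `ξ` is a Lipschitz function of `y`. A cube can be split in two halves
at an arbitrarily small scale (`hasFineSplitting_unitInterval`), so that the cost of this plan is a
limit of costs of transport maps: a solution of Monge's problem would induce an optimal plan, hence
this plan, carried by a graph (`exists_unique_optimalPlan_of_potential`).

The mixed Hessian at a point depends continuously on the cost for the `C²` topology, so invertibility
somewhere is an open condition. It is dense since `c + t φ`, where `φ` is the inner product in charts
near a point, has a mixed Hessian at this point whose determinant is a nonzero polynomial in `t`.
-/

/-! ### The integral of a Jacobian determinant -/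

section DetIntegral

open scoped Pointwise

variable {E : Type*} [NormedAddCommGroup E] [NormedSpace ℝ E] [FiniteDimensional ℝ E]

/-- Lagrange interpolation at `0` for the polynomial `t ↦ det (t + A)`. -/
theorem exists_weights_det_eq_sum (v : ℕ → ℝ) (hv : Function.Injective v) :
    ∃ w : ℕ → ℝ, ∀ A : E →L[ℝ] E, A.det =
      ∑ j ∈ Finset.range (Module.finrank ℝ E + 1),
        w j * (v j • ContinuousLinearMap.id ℝ E + A).det := by
  classical
  refine ⟨fun j => (Lagrange.basis (Finset.range (Module.finrank ℝ E + 1)) v j).eval 0, ?_⟩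
  intro A
  set p := (-(A : E →ₗ[ℝ] E)).charpoly with hp
  have hev : ∀ t : ℝ, p.eval t = (t • ContinuousLinearMap.id ℝ E + A).det := by
    intro t
    rw [hp, LinearMap.eval_charpoly, ContinuousLinearMap.det]
    congr 1
    ext x
    simp [Module.algebraMap_end_apply]
  have hdeg : p.degree < (Finset.range (Module.finrank ℝ E + 1)).card := by
    rw [Finset.card_range]
    refine lt_of_le_of_lt Polynomial.degree_le_natDegree ?_
    rw [hp, LinearMap.charpoly_natDegree]
    exact_mod_cast Nat.lt_succ_self _
  have h := Lagrange.eq_interpolate_of_eval_eq (s := Finset.range (Module.finrank ℝ E + 1))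
    (v := v) (fun j => p.eval (v j)) hv.injOn hdeg (fun i _ => rfl)
  have h0 : A.det = p.eval 0 := by rw [hev 0]; simp
  rw [h0, h, Lagrange.interpolate_apply, Polynomial.eval_finsetSum]
  refine Finset.sum_congr rfl fun j _ => ?_
  simp only [Polynomial.eval_mul, Polynomial.eval_C]
  rw [hev, mul_comm]

/-- Uniformly for `A` in a ball, `det (t + A)` is positive for large `t`, since
`det (t + A) = t ^ d * det (1 + A / t)`. -/
theorem exists_det_smul_id_add_pos (C : ℝ) :
    ∃ Λ : ℝ, 0 < Λ ∧ ∀ t, Λ ≤ t → ∀ A : E →L[ℝ] E, ‖A‖ ≤ C →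
      0 < (t • ContinuousLinearMap.id ℝ E + A).det := by
  have hc : ContinuousAt (fun A : E →L[ℝ] E => (ContinuousLinearMap.id ℝ E + A).det) 0 :=
    (ContinuousLinearMap.continuous_det.comp (continuous_const.add continuous_id)).continuousAt
  have hpos : ∀ᶠ A in 𝓝 (0 : E →L[ℝ] E), 0 < (ContinuousLinearMap.id ℝ E + A).det := by
    apply hc.eventually_const_lt
    simp [ContinuousLinearMap.det]
  obtain ⟨δ, hδ, h⟩ := Metric.eventually_nhds_iff.1 hpos
  refine ⟨max 1 (C / δ + 1), by positivity, fun t ht A hA => ?_⟩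
  have ht1 : 1 ≤ t := (le_max_left _ _).trans ht
  have ht2 : C / δ + 1 ≤ t := (le_max_right _ _).trans ht
  have ht0 : 0 < t := by linarith
  have hlt : C / δ < t := by linarith
  have : t • ContinuousLinearMap.id ℝ E + A =
      t • (ContinuousLinearMap.id ℝ E + t⁻¹ • A) := by
    rw [smul_add, smul_smul, mul_inv_cancel₀ ht0.ne', one_smul]
  rw [this, ContinuousLinearMap.det, ContinuousLinearMap.toLinearMap_smul, LinearMap.det_smul]
  refine mul_pos (by positivity) (h ?_)
  rw [dist_zero_right, norm_smul, norm_inv, Real.norm_of_nonneg ht0.le, inv_mul_lt_iff₀ ht0]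
  calc ‖A‖ ≤ C := hA
    _ < t * δ := by rwa [div_lt_iff₀ hδ] at hlt

theorem bijective_smul_add_of_lipschitz {F : E → E} {C : NNReal} (hF : LipschitzWith C F)
    {t : ℝ} (ht : (C : ℝ) < t) : Function.Bijective (fun x => t • x + F x) := by
  rcases subsingleton_or_nontrivial E with hE | hE
  · exact ⟨fun _ _ _ => Subsingleton.elim _ _, fun y => ⟨y, Subsingleton.elim _ _⟩⟩
  have ht0 : 0 < t := C.2.trans_lt ht
  let f' : E ≃L[ℝ] E := ContinuousLinearEquiv.smulLeft (Units.mk0 t ht0.ne')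
  have hf' : ∀ x, f' x = t • x := fun x => rfl
  have happ : ApproximatesLinearOn (fun x => t • x + F x) (f' : E →L[ℝ] E) Set.univ C := by
    rw [ApproximatesLinearOn.approximatesLinearOn_iff_lipschitzOnWith, lipschitzOnWith_univ]
    convert hF using 1
    ext x
    simp [hf']
  have hn : C < ‖(f'.symm : E →L[ℝ] E)‖₊⁻¹ := by
    have : (f'.symm : E →L[ℝ] E) = t⁻¹ • ContinuousLinearMap.id ℝ E := by
      ext x
      apply f'.injective
      rw [ContinuousLinearEquiv.coe_coe, f'.apply_symm_apply, hf']
      simp [smul_smul, ht0.ne']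
    rw [← NNReal.coe_lt_coe, NNReal.coe_inv, coe_nnnorm, this, norm_smul,
      ContinuousLinearMap.norm_id, mul_one, norm_inv, inv_inv, Real.norm_of_nonneg ht0.le]
    exact ht
  exact ⟨Set.injOn_univ.1 (happ.injOn (Or.inr hn)), happ.surjective (Or.inr hn)⟩

variable [MeasurableSpace E] [BorelSpace E] (μ : Measure E) [μ.IsAddHaarMeasure]

theorem setIntegral_det_smul_id_add {F : E → E} (hF : ContDiff ℝ 1 F) {C : NNReal}
    (hlip : LipschitzWith C F) {B : Set E} (hB : MeasurableSet B) (hsupp : ∀ x ∉ B, F x = 0)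
    {t : ℝ} (ht : (C : ℝ) < t)
    (hdet : ∀ x, 0 < (t • ContinuousLinearMap.id ℝ E + fderiv ℝ F x).det) :
    ∫ x in B, (t • ContinuousLinearMap.id ℝ E + fderiv ℝ F x).det ∂μ =
      t ^ Module.finrank ℝ E * μ.real B := by
  have ht0 : 0 < t := C.2.trans_lt ht
  have hbij := bijective_smul_add_of_lipschitz hlip ht
  have him : (fun x => t • x + F x) '' B = t • B := by
    have h1 : (fun x => t • x + F x) '' Bᶜ = (t • B)ᶜ := by
      rw [← Set.image_smul, ← Set.image_compl_eq (MulAction.bijective₀ ht0.ne')]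
      refine Set.image_congr fun x hx => ?_
      simp [hsupp x hx]
    rw [Set.image_compl_eq hbij] at h1
    exact compl_injective h1
  have hd : ∀ x ∈ B, HasFDerivWithinAt (fun x => t • x + F x)
      (t • ContinuousLinearMap.id ℝ E + fderiv ℝ F x) B x := fun x _ =>
    (((hasFDerivAt_id x).const_smul t).add
      ((hF.differentiable one_ne_zero x).hasFDerivAt)).hasFDerivWithinAt
  have h := integral_image_eq_integral_abs_det_fderiv_smul μ hB hd hbij.1.injOn
    (fun _ => (1 : ℝ))
  simp only [smul_eq_mul, mul_one, abs_of_pos (hdet _)] at h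
  rw [← h, him]
  simp only [integral_const, smul_eq_mul, mul_one, measureReal_restrict_apply_univ]
  rw [measureReal_def, Measure.addHaar_smul, ENNReal.toReal_mul,
    ENNReal.toReal_ofReal (abs_nonneg _), abs_of_pos (by positivity), measureReal_def]

/-- The Jacobian determinant of a compactly supported `C¹` self-map integrates to zero: for large
`t`, the map `t • id + F` is a bijection which maps a large ball `B` onto `t • B`, so that
`∫_B det (t + DF) = t ^ d * μ B`; both sides are polynomials in `t`, hence agree at `t = 0`. -/
theorem integral_det_fderiv_eq_zero [Nontrivial E] {F : E → E} (hF : ContDiff ℝ 1 F)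
    (hs : HasCompactSupport F) : ∫ x, (fderiv ℝ F x).det ∂μ = 0 := by
  obtain ⟨C, hC⟩ := hF.lipschitzWith_of_hasCompactSupport hs one_ne_zero
  obtain ⟨Λ, hΛ, hdet⟩ := exists_det_smul_id_add_pos (E := E) C
  set v : ℕ → ℝ := fun j => max Λ (C + 1) + j with hv
  have hvinj : Function.Injective v := fun i j hij => by simpa [hv] using hij
  obtain ⟨w, hw⟩ := exists_weights_det_eq_sum (E := E) v hvinj
  have hdim : Module.finrank ℝ E ≠ 0 := Module.finrank_pos.ne'
  set B := tsupport F
  have hBc : IsCompact B := hs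
  have hint : ∀ t : ℝ, IntegrableOn
      (fun x => (t • ContinuousLinearMap.id ℝ E + fderiv ℝ F x).det) B μ := fun t =>
    (ContinuousLinearMap.continuous_det.comp
      (continuous_const.add (hF.continuous_fderiv one_ne_zero))).continuousOn.integrableOn_compact
      hBc
  have hB : ∫ x, (fderiv ℝ F x).det ∂μ = ∫ x in B, (fderiv ℝ F x).det ∂μ := by
    refine (setIntegral_eq_integral_of_forall_compl_eq_zero fun x hx => ?_).symm
    have : fderiv ℝ F x = 0 := by
      by_contra h
      exact hx (support_fderiv_subset ℝ h)
    rw [this]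
    simp [ContinuousLinearMap.det]
  have h0 := hw 0
  rw [hB, integral_congr_ae (Filter.Eventually.of_forall fun x => hw (fderiv ℝ F x)),
    integral_finsetSum _ fun j _ => (hint (v j)).const_mul (w j)]
  -- Each term of the sum is unchanged when `DF` is replaced by `0`, and `det 0 = 0`.
  have hterm : ∀ j, ∫ x in B, w j * (v j • ContinuousLinearMap.id ℝ E + fderiv ℝ F x).det ∂μ =
      (w j * (v j • ContinuousLinearMap.id ℝ E + (0 : E →L[ℝ] E)).det) * μ.real B := by
    intro j
    have hj : (0 : ℝ) ≤ j := j.cast_nonneg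
    have h1 : Λ ≤ v j := by
      have := le_max_left Λ (C + 1 : ℝ)
      simp only [hv]; linarith
    have h2 : (C : ℝ) < v j := by
      have := le_max_right Λ (C + 1 : ℝ)
      simp only [hv]; linarith
    rw [integral_const_mul, setIntegral_det_smul_id_add μ hF hC hBc.measurableSet
      (fun x hx => image_eq_zero_of_notMem_tsupport hx) h2
      (fun x => hdet _ h1 _ (norm_fderiv_le_of_lipschitz ℝ hC)), mul_assoc]
    simp [ContinuousLinearMap.det]
  simp only [hterm]
  rw [← Finset.sum_mul, ← h0]
  simp [ContinuousLinearMap.det]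

end DetIntegral

/-! ### Counting preimages by an integral -/

section LocalCount

variable {E : Type*} [NormedAddCommGroup E] [NormedSpace ℝ E] [FiniteDimensional ℝ E]

theorem exists_isOpen_injOn_sign_det_eq {F : E → E} {a : E} (hF : ContDiffAt ℝ 1 F a)
    (ha : (fderiv ℝ F a).det ≠ 0) {T : Set E} (hT : T ∈ 𝓝 a) :
    ∃ O : Set E, IsOpen O ∧ a ∈ O ∧ O ⊆ T ∧ Set.InjOn F O ∧ F '' O ∈ 𝓝 (F a) ∧
      ∀ x ∈ O, DifferentiableAt ℝ F x ∧
        SignType.sign (fderiv ℝ F x).det = SignType.sign (fderiv ℝ F a).det := by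
  have hst : HasStrictFDerivAt F ((fderiv ℝ F a).toContinuousLinearEquivOfDetNeZero ha : E →L[ℝ] E)
      a := by
    rw [ContinuousLinearMap.coe_toContinuousLinearEquivOfDetNeZero]
    exact hF.hasStrictFDerivAt one_ne_zero
  have hsrc := hst.mem_toOpenPartialHomeomorph_source
  have hinj := (hst.toOpenPartialHomeomorph F).injOn
  have hsrc' := (hst.toOpenPartialHomeomorph F).open_source.mem_nhds hsrc
  rw [HasStrictFDerivAt.toOpenPartialHomeomorph_coe] at hinj
  have hdiff : ∀ᶠ x in 𝓝 a, DifferentiableAt ℝ F x :=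
    (hF.eventually (by simp)).mono fun x hx => hx.differentiableAt one_ne_zero
  have hcont : ContinuousAt (fun x => (fderiv ℝ F x).det) a :=
    ContinuousLinearMap.continuous_det.continuousAt.comp (hF.continuousAt_fderiv one_ne_zero)
  have hsign : ∀ᶠ x in 𝓝 a, SignType.sign (fderiv ℝ F x).det = SignType.sign (fderiv ℝ F a).det := by
    rcases lt_or_gt_of_ne ha with h | h
    · filter_upwards [hcont.eventually_lt_const h] with x hx
      rw [sign_neg hx, sign_neg h]
    · filter_upwards [hcont.eventually_const_lt h] with x hx
      rw [sign_pos hx, sign_pos h]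
  obtain ⟨O, hO, hOo, haO⟩ := mem_nhds_iff.1
    (Filter.inter_mem hsrc' (Filter.inter_mem hT (Filter.inter_mem hdiff hsign)))
  refine ⟨O, hOo, haO, fun x hx => (hO hx).2.1, hinj.mono fun x hx => (hO hx).1, ?_,
    fun x hx => (hO hx).2.2⟩
  rw [← hst.map_nhds_eq_of_equiv]
  exact Filter.image_mem_map (hOo.mem_nhds haO)

variable [MeasurableSpace E] [BorelSpace E] (μ : Measure E) [μ.IsAddHaarMeasure]

/-- If `s` is the set of preimages of the regular value `p` in `L`, and `φ` is concentrated near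
`p`, then `∫ φ(F) det DF` counts the points of `s` with signs. -/
theorem exists_nhds_setIntegral_comp_mul_det_eq {F : E → E} {U L W : Set E} (hU : IsOpen U)
    (hL : IsCompact L) (hW : IsOpen W) (hUL : U ⊆ L) (hLW : L ⊆ W) (hF : ContDiffOn ℝ 1 F W)
    {p : E} {s : Finset E} (hsU : ∀ x ∈ s, x ∈ U) (hs : ∀ x ∈ L, F x = p ↔ x ∈ s)
    (hreg : ∀ x ∈ s, (fderiv ℝ F x).det ≠ 0) :
    ∃ V ∈ 𝓝 p, ∀ φ : E → ℝ, Continuous φ → Function.support φ ⊆ V →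
      ∫ x in U, φ (F x) * (fderiv ℝ F x).det ∂μ =
        (∑ x ∈ s, ((SignType.sign (fderiv ℝ F x).det : ℤ) : ℝ)) * ∫ z, φ z ∂μ := by
  classical
  obtain ⟨T, hT, hTd⟩ := s.finite_toSet.t2_separation
  have hat : ∀ x ∈ W, ContDiffAt ℝ 1 F x := fun x hx => hF.contDiffAt (hW.mem_nhds hx)
  have hex : ∀ a : E, ∃ O : Set E, a ∈ s → IsOpen O ∧ a ∈ O ∧ O ⊆ T a ∩ U ∧ Set.InjOn F O ∧
      F '' O ∈ 𝓝 p ∧ ∀ x ∈ O, DifferentiableAt ℝ F x ∧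
        SignType.sign (fderiv ℝ F x).det = SignType.sign (fderiv ℝ F a).det := by
    intro a
    by_cases ha : a ∈ s
    · obtain ⟨O, h⟩ := exists_isOpen_injOn_sign_det_eq (hat a (hLW (hUL (hsU a ha)))) (hreg a ha)
        (((hT a).2.inter hU).mem_nhds ⟨(hT a).1, hsU a ha⟩)
      rw [(hs a (hUL (hsU a ha))).2 ha] at h
      exact ⟨O, fun _ => h⟩
    · exact ⟨∅, fun h => absurd h ha⟩
  choose O hO using hex
  set R := ⋃ a ∈ s, O a with hR
  have hRo : IsOpen R := isOpen_biUnion fun a ha => (hO a ha).1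
  have hRU : R ⊆ U := Set.iUnion₂_subset fun a ha => (hO a ha).2.2.1.trans Set.inter_subset_right
  have hcomp : IsCompact (F '' (L \ R)) :=
    (hL.diff hRo).image_of_continuousOn (hF.continuousOn.mono (Set.sdiff_subset.trans hLW))
  have hp : p ∉ F '' (L \ R) := by
    rintro ⟨x, ⟨hxL, hxR⟩, hx⟩
    have := (hs x hxL).1 hx
    exact hxR (Set.mem_biUnion this (hO x this).2.1)
  -- Over this neighborhood of `p`, the preimage in `L` consists of one sheet in each `O a`.
  refine ⟨(⋂ a ∈ s, F '' O a) ∩ (F '' (L \ R))ᶜ, Filter.inter_mem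
    ((Filter.biInter_finset_mem s).2 fun a ha => (hO a ha).2.2.2.2.1)
    (hcomp.isClosed.isOpen_compl.mem_nhds hp), fun φ hφ hsupp => ?_⟩
  have hφ0 : ∀ z, z ∉ (⋂ a ∈ s, F '' O a) ∩ (F '' (L \ R))ᶜ → φ z = 0 := fun z hz => by
    by_contra h
    exact hz (hsupp h)
  have hint : IntegrableOn (fun x => φ (F x) * (fderiv ℝ F x).det) L μ := by
    refine ContinuousOn.integrableOn_compact hL ?_
    refine (hφ.comp_continuousOn (hF.continuousOn.mono hLW)).mul ?_
    exact ContinuousLinearMap.continuous_det.comp_continuousOn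
      ((hF.continuousOn_fderiv_of_isOpen hW le_rfl).mono hLW)
  rw [setIntegral_eq_of_subset_of_forall_sdiff_eq_zero hU.measurableSet hRU
    (fun x hx => by rw [hφ0 _ fun h => h.2 ⟨x, ⟨hUL hx.1, hx.2⟩, rfl⟩, zero_mul]), hR,
    integral_biUnion_finset s (fun a ha => (hO a ha).1.measurableSet)
      (fun a ha b hb hab => (hTd ha hb hab).mono ((hO a ha).2.2.1.trans Set.inter_subset_left)
        ((hO b hb).2.2.1.trans Set.inter_subset_left))
      (fun a ha => hint.mono_set (((hO a ha).2.2.1.trans Set.inter_subset_right).trans hUL)),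
    Finset.sum_mul]
  refine Finset.sum_congr rfl fun a ha => ?_
  obtain ⟨hOo, -, -, hinj, -, hd⟩ := hO a ha
  have h1 : ∫ z, φ z ∂μ = ∫ z in F '' O a, φ z ∂μ :=
    (setIntegral_eq_integral_of_forall_compl_eq_zero fun z hz =>
      hφ0 z fun h => hz (Set.mem_iInter₂.1 h.1 a ha)).symm
  rw [h1, integral_image_eq_integral_abs_det_fderiv_smul μ hOo.measurableSet
    (fun x hx => (hd x hx).1.hasFDerivAt.hasFDerivWithinAt) hinj, ← integral_const_mul]
  refine setIntegral_congr_fun hOo.measurableSet fun x hx => ?_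
  simp only [smul_eq_mul]
  rw [← (hd x hx).2]
  have : (fderiv ℝ F x).det =
      ((SignType.sign (fderiv ℝ F x).det : ℤ) : ℝ) * |(fderiv ℝ F x).det| := by
    conv_lhs => rw [← sign_mul_abs (fderiv ℝ F x).det]
    congr 1
    cases SignType.sign (fderiv ℝ F x).det <;> simp
  conv_lhs => rw [this]
  ring

/-- A signed count has the same parity as the plain count. -/
theorem even_sum_sign_sub_card {ι : Type*} (s : Finset ι) (d : ι → ℝ) (hd : ∀ i ∈ s, d i ≠ 0) :
    Even (∑ i ∈ s, (SignType.sign (d i) : ℤ) - s.card) := by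
  classical
  rw [Finset.card_eq_sum_ones, Nat.cast_sum, ← Finset.sum_sub_distrib]
  refine Finset.even_sum _ fun i hi => ?_
  rcases lt_or_gt_of_ne (hd i hi) with h | h
  · rw [sign_neg h]; decide
  · rw [sign_pos h]; decide

end LocalCount

/-! ### A map with a bump function as Jacobian determinant -/

section DiagonalMap

variable {n : ℕ}

theorem hasDerivAt_integral_tent (r s : ℝ) :
    HasDerivAt (fun s => ∫ t in (0 : ℝ)..s, max 0 (r - |t|)) (max 0 (r - |s|)) s :=
  (Continuous.integral_hasStrictDerivAt (by fun_prop) 0 s).hasDerivAt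

/-- There is a `C¹` self-map of `ℝⁿ` whose Jacobian determinant is a bump function at `p` with
small support: it acts separately on each coordinate, by a primitive of a tent function. -/
theorem exists_contDiff_det_fderiv_bump (p : EuclideanSpace ℝ (Fin n))
    {U : Set (EuclideanSpace ℝ (Fin n))} (hU : U ∈ 𝓝 p) :
    ∃ Φ : EuclideanSpace ℝ (Fin n) → EuclideanSpace ℝ (Fin n), ContDiff ℝ 1 Φ ∧
      (∀ z, 0 ≤ (fderiv ℝ Φ z).det) ∧ (fderiv ℝ Φ p).det ≠ 0 ∧
      HasCompactSupport (fun z => (fderiv ℝ Φ z).det) ∧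
      Function.support (fun z => (fderiv ℝ Φ z).det) ⊆ U := by
  have hU' : (WithLp.toLp 2) ⁻¹' U ∈ 𝓝 (WithLp.ofLp p) :=
    (PiLp.continuous_toLp 2 (fun _ : Fin n => ℝ)).continuousAt.preimage_mem_nhds hU
  obtain ⟨r, hr, hrU⟩ := Metric.nhds_basis_closedBall.mem_iff.1 hU'
  -- The tent function `b` vanishes outside `[-r, r]`, and `β` is its primitive.
  set b : ℝ → ℝ := fun s => max 0 (r - |s|) with hb
  set β : ℝ → ℝ := fun s => ∫ t in (0 : ℝ)..s, b t with hβ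
  have hβd : ∀ s, HasDerivAt β (b s) s := hasDerivAt_integral_tent r
  have hβ1 : ContDiff ℝ 1 β := by
    rw [contDiff_one_iff_deriv]
    refine ⟨fun s => (hβd s).differentiableAt, ?_⟩
    rw [show deriv β = b from funext fun s => (hβd s).deriv]
    fun_prop
  set Φ : EuclideanSpace ℝ (Fin n) → EuclideanSpace ℝ (Fin n) :=
    fun z => WithLp.toLp 2 fun i => β (z i - p i) with hΦ
  have hΦ1 : ContDiff ℝ 1 Φ := by
    rw [contDiff_euclidean]
    intro i
    exact hβ1.comp (by fun_prop)
  have hcoord : ∀ z v i, fderiv ℝ Φ z v i = b (z i - p i) * v i := by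
    intro z v i
    have h1 : HasFDerivAt (fun z => Φ z i)
        ((EuclideanSpace.proj i : EuclideanSpace ℝ (Fin n) →L[ℝ] ℝ).comp (fderiv ℝ Φ z)) z :=
      (EuclideanSpace.proj i : EuclideanSpace ℝ (Fin n) →L[ℝ] ℝ).hasFDerivAt.comp z
        (hΦ1.differentiable one_ne_zero z).hasFDerivAt
    have h3 : HasFDerivAt (fun z : EuclideanSpace ℝ (Fin n) => z i - p i)
        (EuclideanSpace.proj i : EuclideanSpace ℝ (Fin n) →L[ℝ] ℝ) z :=
      (EuclideanSpace.proj i : EuclideanSpace ℝ (Fin n) →L[ℝ] ℝ).hasFDerivAt.sub_const (p i)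
    have h2 : HasFDerivAt (fun z => Φ z i)
        (b (z i - p i) • (EuclideanSpace.proj i : EuclideanSpace ℝ (Fin n) →L[ℝ] ℝ)) z :=
      HasDerivAt.comp_hasFDerivAt (h₂ := β) z (hβd (z i - p i)) h3
    have := congrArg (fun l => l v) (h1.unique h2)
    simpa using this
  have hdet : ∀ z, (fderiv ℝ Φ z).det = ∏ i, b (z i - p i) := by
    intro z
    rw [ContinuousLinearMap.det, ← LinearMap.det_toMatrix (EuclideanSpace.basisFun (Fin n) ℝ).toBasis]
    have : LinearMap.toMatrix (EuclideanSpace.basisFun (Fin n) ℝ).toBasis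
        (EuclideanSpace.basisFun (Fin n) ℝ).toBasis (fderiv ℝ Φ z : _ →ₗ[ℝ] _) =
        Matrix.diagonal fun i => b (z i - p i) := by
      ext i j
      rw [LinearMap.toMatrix_apply]
      simp only [OrthonormalBasis.coe_toBasis, ContinuousLinearMap.coe_coe,
        OrthonormalBasis.coe_toBasis_repr_apply, EuclideanSpace.basisFun_repr, hcoord,
        EuclideanSpace.basisFun_apply, Matrix.diagonal_apply]
      by_cases h : i = j <;> simp [h]
    rw [this, Matrix.det_diagonal]
  have hsub : Function.support (fun z => (fderiv ℝ Φ z).det) ⊆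
      (WithLp.toLp 2) '' Metric.closedBall (WithLp.ofLp p) r := by
    intro z hz
    refine ⟨WithLp.ofLp z, ?_, rfl⟩
    rw [Function.mem_support, hdet, Finset.prod_ne_zero_iff] at hz
    rw [Metric.mem_closedBall, dist_pi_le_iff hr.le]
    intro i
    by_contra h
    refine hz i (Finset.mem_univ i) (max_eq_left ?_)
    rw [not_le, Real.dist_eq] at h
    linarith
  refine ⟨Φ, hΦ1, fun z => ?_, ?_, ?_, ?_⟩
  · rw [hdet]
    exact Finset.prod_nonneg fun i _ => le_max_left _ _
  · rw [hdet, Finset.prod_ne_zero_iff]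
    intro i _
    simp only [hb, sub_self, abs_zero, sub_zero]
    exact (lt_max_of_lt_right hr).ne'
  · refine HasCompactSupport.intro
      ((isCompact_closedBall (WithLp.ofLp p) r).image (PiLp.continuous_toLp 2 _)) fun z hz => ?_
    by_contra h
    exact hz (hsub h)
  · refine hsub.trans ?_
    rintro _ ⟨z, hz, rfl⟩
    exact hrU hz

end DiagonalMap

/-! ### Parity of the number of preimages in Euclidean space -/

section LocalParity

theorem contDiff_smul_of_tsupport_subset {E G : Type*} [NormedAddCommGroup E] [NormedSpace ℝ E]
    [NormedAddCommGroup G] [NormedSpace ℝ G] {k : WithTop ℕ∞} {ζ : E → ℝ} (hζ : ContDiff ℝ k ζ)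
    {f : E → G} {W : Set E} (hW : IsOpen W) (hf : ContDiffOn ℝ k f W) (hs : tsupport ζ ⊆ W) :
    ContDiff ℝ k (fun x => ζ x • f x) := by
  rw [contDiff_iff_contDiffAt]
  intro x
  by_cases hx : x ∈ tsupport ζ
  · exact hζ.contDiffAt.smul (hf.contDiffAt (hW.mem_nhds (hs hx)))
  · have : (fun x => ζ x • f x) =ᶠ[𝓝 x] fun _ => 0 := by
      filter_upwards [(isClosed_tsupport ζ).isOpen_compl.mem_nhds hx] with y hy
      rw [image_eq_zero_of_notMem_tsupport hy, zero_smul]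
    exact contDiffAt_const.congr_of_eventuallyEq this

theorem exists_contDiff_cutoff {E : Type*} [NormedAddCommGroup E] [NormedSpace ℝ E]
    [FiniteDimensional ℝ E] {L W : Set E} (hL : IsCompact L) (hW : IsOpen W) (hLW : L ⊆ W) :
    ∃ ζ : E → ℝ, ContDiff ℝ 1 ζ ∧ HasCompactSupport ζ ∧ tsupport ζ ⊆ W ∧ ∀ x ∈ L, ζ x = 1 := by
  obtain ⟨L', hL', hLL', hLW'⟩ := exists_compact_between hL hW hLW
  obtain ⟨ζ, hζ, -, h0, h1⟩ := exists_contMDiff_zero_iff_one_iff_of_isClosed (n := 1) 𝓘(ℝ, E)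
    isOpen_interior.isClosed_compl hL.isClosed
    (Set.disjoint_left.2 fun x hx hx' => hx (hLL' hx'))
  have hsub : Function.support ζ ⊆ L' := fun x hx => by
    by_contra h
    exact hx ((h0 x).1 fun h' => h (interior_subset h'))
  have hts : tsupport ζ ⊆ L' := closure_minimal hsub hL'.isClosed
  exact ⟨ζ, hζ.contDiff, hL'.of_isClosed_subset (isClosed_tsupport ζ) hts, hts.trans hLW',
    fun x hx => (h1 x).1 hx⟩

variable {n : ℕ}

/-- Invariance of the degree modulo two under a modification with compact support: with
`φ = det DΦ` a bump function near `p`, the signed counts of `s` and `t` are proportional to the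
integrals of `det D(Φ ∘ F)` and `det D(Φ ∘ G)`, which agree because the two maps differ only in a
compact set. -/
theorem even_card_sub_card {F G : EuclideanSpace ℝ (Fin n) → EuclideanSpace ℝ (Fin n)}
    (hn : 1 ≤ n) {W K : Set (EuclideanSpace ℝ (Fin n))} (hW : IsOpen W) (hK : IsCompact K)
    (hKW : K ⊆ W) (hF : ContDiffOn ℝ 1 F W) (hG : ContDiffOn ℝ 1 G W)
    (hFG : ∀ x ∈ W, x ∉ K → F x = G x) {p : EuclideanSpace ℝ (Fin n)}
    {s t : Finset (EuclideanSpace ℝ (Fin n))} (hs : ∀ x, x ∈ s ↔ x ∈ W ∧ F x = p)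
    (ht : ∀ x, x ∈ t ↔ x ∈ W ∧ G x = p) (hsreg : ∀ x ∈ s, (fderiv ℝ F x).det ≠ 0)
    (htreg : ∀ x ∈ t, (fderiv ℝ G x).det ≠ 0) : Even ((s.card : ℤ) - t.card) := by
  have : Nontrivial (EuclideanSpace ℝ (Fin n)) := by
    have : Nonempty (Fin n) := ⟨⟨0, hn⟩⟩
    infer_instance
  obtain ⟨L, hL, hKL, hLW⟩ := exists_compact_between
    ((hK.union s.finite_toSet.isCompact).union t.finite_toSet.isCompact) hW
    (Set.union_subset (Set.union_subset hKW fun x hx => ((hs x).1 hx).1)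
      fun x hx => ((ht x).1 hx).1)
  set U := interior L
  have hKU : K ⊆ U := fun x hx => hKL (Or.inl (Or.inl hx))
  have hsU : ∀ x ∈ s, x ∈ U := fun x hx => hKL (Or.inl (Or.inr hx))
  have htU : ∀ x ∈ t, x ∈ U := fun x hx => hKL (Or.inr hx)
  obtain ⟨V₁, hV₁, h₁⟩ := exists_nhds_setIntegral_comp_mul_det_eq volume isOpen_interior hL hW
    interior_subset hLW hF hsU (fun x hx => by rw [hs]; exact ⟨fun h => ⟨hLW hx, h⟩, fun h => h.2⟩)
    hsreg
  obtain ⟨V₂, hV₂, h₂⟩ := exists_nhds_setIntegral_comp_mul_det_eq volume isOpen_interior hL hW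
    interior_subset hLW hG htU (fun x hx => by rw [ht]; exact ⟨fun h => ⟨hLW hx, h⟩, fun h => h.2⟩)
    htreg
  obtain ⟨Φ, hΦ, hΦ0, hΦp, hΦc, hΦs⟩ := exists_contDiff_det_fderiv_bump p (Filter.inter_mem hV₁ hV₂)
  have hφ : Continuous fun z => (fderiv ℝ Φ z).det :=
    ContinuousLinearMap.continuous_det.comp (hΦ.continuous_fderiv one_ne_zero)
  have hpos := Continuous.integral_pos_of_hasCompactSupport_nonneg_nonzero (μ := volume) hφ hΦc
    hΦ0 hΦp
  obtain ⟨ζ, hζ, hζc, hζW, hζ1⟩ := exists_contDiff_cutoff hL hW hLW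
  -- For either map, the integral over `U` is a local contribution to the vanishing integral of
  -- the Jacobian of the cut-off composition with `Φ`.
  have key : ∀ H : EuclideanSpace ℝ (Fin n) → EuclideanSpace ℝ (Fin n), ContDiffOn ℝ 1 H W →
      (∫ x in U, (fderiv ℝ Φ (H x)).det * (fderiv ℝ H x).det) +
        (∫ x in Uᶜ, (fderiv ℝ (fun x => ζ x • Φ (H x)) x).det) = 0 := by
    intro H hH
    have hA := contDiff_smul_of_tsupport_subset hζ hW (hΦ.comp_contDiffOn hH) hζW
    have hAc : HasCompactSupport (fun x => ζ x • (Φ ∘ H) x) := hζc.smul_right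
    rw [← integral_det_fderiv_eq_zero volume hA hAc, ← integral_add_compl (μ := volume)
      (isOpen_interior : IsOpen U).measurableSet (f := fun x => (fderiv ℝ (fun x => ζ x • (Φ ∘ H) x) x).det)]
    · congr 1
      refine setIntegral_congr_fun isOpen_interior.measurableSet fun x hx => ?_
      have hxW := hLW (interior_subset hx)
      have heq : (fun x => ζ x • (Φ ∘ H) x) =ᶠ[𝓝 x] Φ ∘ H := by
        filter_upwards [isOpen_interior.mem_nhds hx] with y hy
        rw [hζ1 y (interior_subset hy), one_smul]
      rw [heq.fderiv_eq, fderiv_comp x (hΦ.differentiable one_ne_zero _)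
        ((hH.contDiffAt (hW.mem_nhds hxW)).differentiableAt one_ne_zero)]
      simp [ContinuousLinearMap.det, LinearMap.det_comp]
    · refine Continuous.integrable_of_hasCompactSupport
        (ContinuousLinearMap.continuous_det.comp (hA.continuous_fderiv one_ne_zero)) ?_
      refine (hAc.fderiv ℝ).comp_left (g := ContinuousLinearMap.det) ?_
      simp [ContinuousLinearMap.det]
  have hF' := key F hF
  have hG' := key G hG
  -- Outside `U` the two cut-off compositions coincide, as `F = G` off `K`.
  have hcompl : ∫ x in Uᶜ, (fderiv ℝ (fun x => ζ x • Φ (F x)) x).det =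
      ∫ x in Uᶜ, (fderiv ℝ (fun x => ζ x • Φ (G x)) x).det := by
    refine setIntegral_congr_fun isOpen_interior.measurableSet.compl fun x hx => ?_
    have heq : (fun x => ζ x • Φ (F x)) =ᶠ[𝓝 x] fun x => ζ x • Φ (G x) := by
      filter_upwards [hK.isClosed.isOpen_compl.mem_nhds fun h => hx (hKU h)] with y hy
      by_cases hyW : y ∈ W
      · rw [hFG y hyW hy]
      · rw [image_eq_zero_of_notMem_tsupport fun h => hyW (hζW h), zero_smul, zero_smul]
    rw [heq.fderiv_eq]
  have e₁ := h₁ _ hφ (hΦs.trans Set.inter_subset_left)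
  have e₂ := h₂ _ hφ (hΦs.trans Set.inter_subset_right)
  have hsum : (∑ x ∈ s, ((SignType.sign (fderiv ℝ F x).det : ℤ) : ℝ)) =
      ∑ x ∈ t, ((SignType.sign (fderiv ℝ G x).det : ℤ) : ℝ) := by
    apply mul_right_cancel₀ hpos.ne'
    rw [← e₁, ← e₂]
    change (∫ x in U, _) = ∫ x in U, _
    linarith
  have hsum' : ∑ x ∈ s, (SignType.sign (fderiv ℝ F x).det : ℤ) =
      ∑ x ∈ t, (SignType.sign (fderiv ℝ G x).det : ℤ) := by exact_mod_cast hsum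
  have := (even_sum_sign_sub_card t _ htreg).sub (even_sum_sign_sub_card s _ hsreg)
  rw [hsum'] at this
  simpa using this

end LocalParity

/-! ### Parity of the number of preimages on a closed manifold -/

section ManifoldParity

variable {n : ℕ} {N : Type*} [TopologicalSpace N] [ChartedSpace (EuclideanSpace ℝ (Fin n)) N]

theorem ContinuousLinearMap.det_ne_zero_iff_bijective {E : Type*} [NormedAddCommGroup E]
    [NormedSpace ℝ E] [FiniteDimensional ℝ E] (A : E →L[ℝ] E) :
    A.det ≠ 0 ↔ Function.Bijective A := by
  constructor
  · intro h
    rw [← ContinuousLinearMap.coe_toContinuousLinearEquivOfDetNeZero A h]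
    exact (A.toContinuousLinearEquivOfDetNeZero h).bijective
  · intro h
    have := (LinearEquiv.ofBijective (A : E →ₗ[ℝ] E) h).isUnit_det'
    exact this.ne_zero

/-- In a chart, the differential of `f` changes by an invertible linear map. -/
theorem fderiv_comp_chart_symm {G : Type*} [NormedAddCommGroup G] [NormedSpace ℝ G]
    [IsManifold (𝓡 n) ∞ N] {f : N → G} (z : N) {y : N}
    (hy : y ∈ (chartAt (EuclideanSpace ℝ (Fin n)) z).source)
    (hf : MDifferentiableAt (𝓡 n) 𝓘(ℝ, G) f y) :
    ∃ A : EuclideanSpace ℝ (Fin n) →L[ℝ] EuclideanSpace ℝ (Fin n), Function.Bijective A ∧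
      ∀ v, fderiv ℝ (f ∘ (chartAt (EuclideanSpace ℝ (Fin n)) z).symm)
        (chartAt (EuclideanSpace ℝ (Fin n)) z y) v = mfderiv (𝓡 n) 𝓘(ℝ, G) f y (A v) := by
  have : IsManifold (𝓡 n) 1 N := IsManifold.of_le (n := ∞) (by norm_cast)
  set e := chartAt (EuclideanSpace ℝ (Fin n)) z
  have he : e.MDifferentiable (𝓡 n) (𝓡 n) :=
    mdifferentiable_of_mem_atlas (chart_mem_atlas _ z)
  have hey : e y ∈ e.symm.source := e.map_source hy
  refine ⟨mfderiv (𝓡 n) (𝓡 n) e.symm (e y), he.symm.mfderiv_bijective hey, fun v => ?_⟩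
  have h := mfderiv_comp (I := 𝓡 n) (I' := 𝓡 n) (I'' := 𝓘(ℝ, G)) (e y) (f := e.symm) (g := f)
    (by rwa [e.left_inv hy]) (he.symm.mdifferentiableAt hey)
  rw [mfderiv_eq_fderiv] at h
  rw [h]
  change mfderiv (𝓡 n) 𝓘(ℝ, G) f (e.symm (e y)) (mfderiv (𝓡 n) (𝓡 n) e.symm (e y) v) = _
  rw [e.left_inv hy]
  rfl

theorem det_fderiv_comp_chart_symm_ne_zero_iff [IsManifold (𝓡 n) ∞ N]
    {f : N → EuclideanSpace ℝ (Fin n)} (z : N) {y : N}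
    (hy : y ∈ (chartAt (EuclideanSpace ℝ (Fin n)) z).source)
    (hf : MDifferentiableAt (𝓡 n) (𝓡 n) f y) :
    (fderiv ℝ (f ∘ (chartAt (EuclideanSpace ℝ (Fin n)) z).symm)
      (chartAt (EuclideanSpace ℝ (Fin n)) z y)).det ≠ 0 ↔
      Function.Bijective (mfderiv (𝓡 n) (𝓡 n) f y) := by
  obtain ⟨A, hA, h⟩ := fderiv_comp_chart_symm z hy hf
  rw [ContinuousLinearMap.det_ne_zero_iff_bijective, funext h]
  exact Function.Bijective.of_comp_iff _ hA

theorem contDiffOn_comp_chart_symm [IsManifold (𝓡 n) ∞ N] {G : Type*} [NormedAddCommGroup G]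
    [NormedSpace ℝ G] {f : N → G} (hf : ContMDiff (𝓡 n) 𝓘(ℝ, G) 1 f) (z : N) :
    ContDiffOn ℝ 1 (f ∘ (chartAt (EuclideanSpace ℝ (Fin n)) z).symm)
      (chartAt (EuclideanSpace ℝ (Fin n)) z).target := by
  have : IsManifold (𝓡 n) 1 N := IsManifold.of_le (n := ∞) (by norm_cast)
  rw [← contMDiffOn_iff_contDiffOn]
  exact hf.comp_contMDiffOn contMDiffOn_chart_symm

variable [IsManifold (𝓡 n) ∞ N]

theorem exists_nhds_injOn_of_bijective_mfderiv {f : N → EuclideanSpace ℝ (Fin n)}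
    (hf : ContMDiff (𝓡 n) (𝓡 n) 1 f) {y : N}
    (hy : Function.Bijective (mfderiv (𝓡 n) (𝓡 n) f y)) :
    ∃ O ∈ 𝓝 y, Set.InjOn f O ∧ f '' O ∈ 𝓝 (f y) := by
  set e := chartAt (EuclideanSpace ℝ (Fin n)) y with he
  have hys : y ∈ e.source := mem_chart_source _ y
  have hdet := (det_fderiv_comp_chart_symm_ne_zero_iff y hys
    (hf.mdifferentiableAt one_ne_zero)).2 hy
  have ht : e.target ∈ 𝓝 (e y) := e.open_target.mem_nhds (e.map_source hys)
  obtain ⟨O, hO, hyO, hOt, hinj, hnhds, -⟩ := exists_isOpen_injOn_sign_det_eq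
    ((contDiffOn_comp_chart_symm hf y).contDiffAt ht) hdet ht
  have hmem : e y ∈ O := hyO
  refine ⟨e.source ∩ e ⁻¹' O, Filter.inter_mem (e.open_source.mem_nhds hys)
    ((e.continuousAt hys).preimage_mem_nhds (hO.mem_nhds hmem)), ?_, ?_⟩
  · intro a ha b hb hab
    have := hinj ha.2 hb.2 (by simp [← he, e.left_inv ha.1, e.left_inv hb.1, hab])
    rw [← e.left_inv ha.1, ← e.left_inv hb.1, this]
  · simp only [Function.comp_apply, ← he, e.left_inv hys] at hnhds
    refine Filter.mem_of_superset hnhds ?_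
    rintro _ ⟨x, hx, rfl⟩
    refine ⟨e.symm x, ⟨e.map_target (hOt hx), ?_⟩, rfl⟩
    simpa [e.right_inv (hOt hx)] using hx

variable [CompactSpace N]

/-- Sard's theorem for `C¹` maps between manifolds of equal dimension. -/
theorem ae_regular_value {f : N → EuclideanSpace ℝ (Fin n)} (hf : ContMDiff (𝓡 n) (𝓡 n) 1 f) :
    ∀ᵐ p, ∀ y, f y = p → Function.Bijective (mfderiv (𝓡 n) (𝓡 n) f y) := by
  obtain ⟨t, ht⟩ := CompactSpace.elim_nhds_subcover
    (fun z : N => (chartAt (EuclideanSpace ℝ (Fin n)) z).source)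
    (fun z => chart_source_mem_nhds _ z)
  have h : ∀ z ∈ t, ∀ᵐ p, ∀ y ∈ (chartAt (EuclideanSpace ℝ (Fin n)) z).source, f y = p →
      Function.Bijective (mfderiv (𝓡 n) (𝓡 n) f y) := by
    intro z _
    set e := chartAt (EuclideanSpace ℝ (Fin n)) z
    have h0 := addHaar_image_eq_zero_of_det_fderivWithin_eq_zero volume
      (s := {x | x ∈ e.target ∧ (fderiv ℝ (f ∘ e.symm) x).det = 0}) (f := f ∘ e.symm)
      (f' := fderiv ℝ (f ∘ e.symm))
      (fun x hx => (((contDiffOn_comp_chart_symm hf z).contDiffAt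
        (e.open_target.mem_nhds hx.1)).differentiableAt one_ne_zero).hasFDerivAt.hasFDerivWithinAt)
      (fun x hx => hx.2)
    rw [measure_eq_zero_iff_ae_notMem] at h0
    filter_upwards [h0] with p hp y hy hyp
    rw [← det_fderiv_comp_chart_symm_ne_zero_iff z hy (hf.mdifferentiableAt one_ne_zero)]
    intro hdet
    refine hp ⟨e y, ⟨e.map_source hy, hdet⟩, ?_⟩
    simp [e.left_inv hy, hyp]
  filter_upwards [(Filter.eventually_all_finset t).2 h] with p hp y hyp
  have : y ∈ ⋃ z ∈ t, (chartAt (EuclideanSpace ℝ (Fin n)) z).source := ht ▸ Set.mem_univ y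
  obtain ⟨z, hz, hyz⟩ := Set.mem_iUnion₂.1 this
  exact hp z hz y hyz hyp

theorem finite_preimage_of_regular_value {f : N → EuclideanSpace ℝ (Fin n)}
    (hf : ContMDiff (𝓡 n) (𝓡 n) 1 f) {p : EuclideanSpace ℝ (Fin n)}
    (hp : ∀ y, f y = p → Function.Bijective (mfderiv (𝓡 n) (𝓡 n) f y)) :
    (f ⁻¹' {p}).Finite := by
  have hc : IsCompact (f ⁻¹' {p}) := (isClosed_singleton.preimage hf.continuous).isCompact
  refine hc.induction_on (p := Set.Finite) Set.finite_empty (fun s t hst ht => ht.subset hst)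
    (fun s t hs ht => hs.union ht) fun y hy => ?_
  obtain ⟨O, hO, hinj, -⟩ := exists_nhds_injOn_of_bijective_mfderiv hf (hp y hy)
  refine ⟨f ⁻¹' {p} ∩ O, inter_mem_nhdsWithin _ hO, Set.Subsingleton.finite ?_⟩
  intro a ha b hb
  exact hinj ha.2 hb.2 (ha.1.trans hb.1.symm)

/-- A modification inside one chart does not change the parity of the number of preimages of a
common regular value. -/
theorem ae_even_ncard_sub_ncard [T2Space N] (hn : 1 ≤ n) {f g : N → EuclideanSpace ℝ (Fin n)}
    (hf : ContMDiff (𝓡 n) (𝓡 n) 1 f) (hg : ContMDiff (𝓡 n) (𝓡 n) 1 g) {z : N} {K : Set N}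
    (hK : IsCompact K) (hKz : K ⊆ (chartAt (EuclideanSpace ℝ (Fin n)) z).source)
    (hfg : ∀ y ∉ K, f y = g y) :
    ∀ᵐ p, Even (((f ⁻¹' {p}).ncard : ℤ) - (g ⁻¹' {p}).ncard) := by
  classical
  filter_upwards [ae_regular_value hf, ae_regular_value hg] with p hpf hpg
  set e := chartAt (EuclideanSpace ℝ (Fin n)) z
  have aux : ∀ h : N → EuclideanSpace ℝ (Fin n), ContMDiff (𝓡 n) (𝓡 n) 1 h →
      (∀ y, h y = p → Function.Bijective (mfderiv (𝓡 n) (𝓡 n) h y)) →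
      ∃ s : Finset (EuclideanSpace ℝ (Fin n)), (∀ x, x ∈ s ↔ x ∈ e.target ∧ (h ∘ e.symm) x = p) ∧
        (∀ x ∈ s, (fderiv ℝ (h ∘ e.symm) x).det ≠ 0) ∧
        (h ⁻¹' {p}).ncard = s.card + (h ⁻¹' {p} \ e.source).ncard := by
    intro h hh hp
    have hfin := finite_preimage_of_regular_value hh hp
    have hfin' : (h ⁻¹' {p} ∩ e.source).Finite := hfin.inter_of_left _
    have hmem : ∀ x, x ∈ (hfin'.image e).toFinset ↔ x ∈ e.target ∧ (h ∘ e.symm) x = p := by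
      intro x
      rw [Set.Finite.mem_toFinset]
      constructor
      · rintro ⟨y, ⟨hy, hys⟩, rfl⟩
        refine ⟨e.map_source hys, ?_⟩
        rw [Function.comp_apply, e.left_inv hys]
        exact hy
      · rintro ⟨hx, hxp⟩
        exact ⟨e.symm x, ⟨hxp, e.map_target hx⟩, e.right_inv hx⟩
    refine ⟨(hfin'.image e).toFinset, hmem, fun x hx => ?_, ?_⟩
    · obtain ⟨hxt, hxp⟩ := (hmem x).1 hx
      have := (det_fderiv_comp_chart_symm_ne_zero_iff z (e.map_target hxt)
        (hh.mdifferentiableAt one_ne_zero)).2 (hp _ hxp)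
      rwa [e.right_inv hxt] at this
    · rw [← Set.ncard_eq_toFinset_card _ (hfin'.image e),
        (e.injOn.mono Set.inter_subset_right).ncard_image]
      exact (Set.ncard_inter_add_ncard_sdiff_eq_ncard _ _ hfin).symm
  obtain ⟨s, hs, hsreg, hscard⟩ := aux f hf hpf
  obtain ⟨t, ht, htreg, htcard⟩ := aux g hg hpg
  have hdiff : f ⁻¹' {p} \ e.source = g ⁻¹' {p} \ e.source := by
    ext y
    simp only [Set.mem_sdiff, Set.mem_preimage, Set.mem_singleton_iff]
    exact and_congr_left fun hy => by rw [hfg y fun h => hy (hKz h)]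
  have := even_card_sub_card hn e.open_target
    (hK.image_of_continuousOn (e.continuousOn.mono hKz))
    (Set.image_subset_iff.2 fun y hy => e.map_source (hKz hy))
    (contDiffOn_comp_chart_symm hf z) (contDiffOn_comp_chart_symm hg z)
    (fun x hx hxK => hfg _ fun h => hxK ⟨_, h, e.right_inv hx⟩) hs ht hsreg htreg
  rw [hscard, htcard, hdiff]
  push_cast
  rwa [add_sub_add_right_eq_sub]

/-- Almost every point has an even number of preimages under a `C¹` map from a closed `n`-manifold
to `ℝⁿ`: the map is deformed to `0` by multiplying it successively by finitely many functions
`1 - χ`, where `χ` is a bump function supported in a chart. -/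
theorem ae_even_ncard_preimage [T2Space N] (hn : 1 ≤ n) {f : N → EuclideanSpace ℝ (Fin n)}
    (hf : ContMDiff (𝓡 n) (𝓡 n) 1 f) : ∀ᵐ p, Even (f ⁻¹' {p}).ncard := by
  classical
  let χ : ∀ z : N, SmoothBumpFunction (𝓡 n) z := fun z => Classical.arbitrary _
  obtain ⟨t, ht⟩ := CompactSpace.elim_nhds_subcover (fun z : N => {y | χ z y = 1})
    (fun z => (χ z).eventuallyEq_one)
  let g : Finset N → N → EuclideanSpace ℝ (Fin n) := fun S y => (∏ z ∈ S, (1 - χ z y)) • f y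
  have hg : ∀ S, ContMDiff (𝓡 n) (𝓡 n) 1 (g S) := by
    intro S
    suffices h : ContMDiff (𝓡 n) 𝓘(ℝ, ℝ) 1 fun y => ∏ z ∈ S, (1 - χ z y) from h.smul hf
    refine contMDiff_finsetProd fun z _ => ?_
    exact contMDiff_const.sub ((χ z).contMDiff.of_le (by norm_cast))
  have hev : ∀ S, ∀ᵐ p, Even (((f ⁻¹' {p}).ncard : ℤ) - (g S ⁻¹' {p}).ncard) := by
    intro S
    induction S using Finset.induction_on with
    | empty =>
      refine Filter.Eventually.of_forall fun p => ?_
      have : g ∅ = f := by ext1 y; simp [g]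
      rw [this, sub_self]
      exact Even.zero
    | insert z S hz ih =>
      have hstep := ae_even_ncard_sub_ncard hn (hg S) (hg (insert z S))
        (χ z).hasCompactSupport.isCompact (χ z).tsupport_subset_chartAt_source (fun y hy => by
          simp only [g]
          rw [Finset.prod_insert hz, image_eq_zero_of_notMem_tsupport hy, sub_zero, one_mul])
      filter_upwards [ih, hstep] with p h1 h2
      have := h1.add h2
      rwa [sub_add_sub_cancel] at this
  have hgt : ∀ y, g t y = 0 := by
    intro y
    have : y ∈ ⋃ z ∈ t, {y | χ z y = 1} := ht ▸ Set.mem_univ y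
    obtain ⟨z, hz, hyz⟩ := Set.mem_iUnion₂.1 this
    simp only [g]
    rw [Finset.prod_eq_zero hz (by rw [show χ z y = 1 from hyz, sub_self]), zero_smul]
  have : Nontrivial (EuclideanSpace ℝ (Fin n)) := by
    have : Nonempty (Fin n) := ⟨⟨0, hn⟩⟩
    infer_instance
  filter_upwards [hev t, measure_eq_zero_iff_ae_notMem.1
    (measure_singleton (μ := volume) (0 : EuclideanSpace ℝ (Fin n)))] with p hp hp0
  have hempty : g t ⁻¹' {p} = ∅ := by
    ext y
    simp only [Set.mem_preimage, Set.mem_singleton_iff, Set.mem_empty_iff_false, iff_false, hgt]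
    exact fun h => hp0 h.symm
  rw [hempty, Set.ncard_empty, Nat.cast_zero, sub_zero] at hp
  exact_mod_cast hp

/-- A `C¹` map from a closed `n`-manifold to `ℝⁿ` which is a local diffeomorphism at some point
takes a common value at two points where it is one: its image contains an open set, hence a regular
value with a positive and even number of preimages. -/
theorem exists_ne_map_eq_of_bijective_mfderiv [T2Space N] (hn : 1 ≤ n)
    {f : N → EuclideanSpace ℝ (Fin n)} (hf : ContMDiff (𝓡 n) (𝓡 n) 1 f) {y : N}
    (hy : Function.Bijective (mfderiv (𝓡 n) (𝓡 n) f y)) :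
    ∃ y₁ y₂, y₁ ≠ y₂ ∧ f y₁ = f y₂ ∧ Function.Bijective (mfderiv (𝓡 n) (𝓡 n) f y₁) ∧
      Function.Bijective (mfderiv (𝓡 n) (𝓡 n) f y₂) := by
  obtain ⟨O, -, -, hO⟩ := exists_nhds_injOn_of_bijective_mfderiv hf hy
  have hfreq : ∃ᵐ p, p ∈ f '' O := by
    rw [frequently_ae_mem_iff]
    exact (Measure.measure_pos_of_mem_nhds volume hO).ne'
  obtain ⟨p, hpO, hpe, hpr⟩ :=
    (hfreq.and_eventually ((ae_even_ncard_preimage hn hf).and (ae_regular_value hf))).exists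
  have hfin := finite_preimage_of_regular_value hf hpr
  obtain ⟨y₁, -, hy₁⟩ := hpO
  have hpos : 0 < (f ⁻¹' {p}).ncard := (Set.ncard_pos hfin).2 ⟨y₁, hy₁⟩
  have h1 : 1 < (f ⁻¹' {p}).ncard := by
    obtain ⟨k, hk⟩ := hpe
    omega
  obtain ⟨a, b, ha, hb, hab⟩ := (Set.one_lt_ncard_iff hfin).1 h1
  exact ⟨a, b, hab, ha.trans hb.symm, hpr a ha, hpr b hb⟩

end ManifoldParity

/-! ### Splitting a measure in two halves at a small scale -/

section FairCoin

/-- The law of a fair coin. -/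
noncomputable def fairCoin : Measure Bool := (2⁻¹ : ENNReal) • Measure.count

instance : IsProbabilityMeasure fairCoin := ⟨by
  rw [fairCoin, Measure.smul_apply, Measure.count_apply_finite _ Set.finite_univ, smul_eq_mul]
  simpa using ENNReal.inv_mul_cancel (a := 2) (by simp) (by simp)⟩

theorem ae_fairCoin_iff {P : Bool → Prop} : (∀ᵐ b ∂fairCoin, P b) ↔ ∀ b, P b := by
  rw [fairCoin, Measure.ae_ennreal_smul_measure_iff (by simp), Measure.ae_count_iff]

/-- The measure `ρ` can be split in two halves at an arbitrarily small scale: there are maps which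
move points by at most `ε` and which, together with a suitable `Bool`-valued map, carry `ρ` to the
product of `ρ` with a fair coin. -/
def HasFineSplitting {X : Type*} [MetricSpace X] [MeasurableSpace X] (ρ : Measure X) : Prop :=
  ∀ ε > 0, ∃ R : X → X × Bool, MeasurePreserving R ρ (ρ.prod fairCoin) ∧
    ∀ x, dist (R x).1 x ≤ ε

theorem HasFineSplitting.prod {X Y : Type*} [MetricSpace X] [MeasurableSpace X] [MetricSpace Y]
    [MeasurableSpace Y] {ρ : Measure X} [IsProbabilityMeasure ρ] (h : HasFineSplitting ρ)
    (η : Measure Y) [IsProbabilityMeasure η] : HasFineSplitting (ρ.prod η) := by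
  intro ε hε
  obtain ⟨R, hR, hd⟩ := h ε hε
  have h1 : MeasurePreserving (Prod.map R id) (ρ.prod η) ((ρ.prod fairCoin).prod η) :=
    hR.prod (MeasurePreserving.id η)
  have h2 := measurePreserving_prodAssoc ρ fairCoin η
  have h3 : MeasurePreserving (Prod.map id Prod.swap) (ρ.prod (fairCoin.prod η))
      (ρ.prod (η.prod fairCoin)) := (MeasurePreserving.id ρ).prod Measure.measurePreserving_swap
  have h4 := (measurePreserving_prodAssoc ρ η fairCoin).symm MeasurableEquiv.prodAssoc
  refine ⟨_, h4.comp (h3.comp (h2.comp h1)), fun x => ?_⟩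
  change dist ((R x.1).1, x.2) x ≤ ε
  rw [Prod.dist_eq]
  exact max_le (hd x.1) (by simpa using hε.le)

open unitInterval in
/-- The gluing of two copies of the unit interval, each of them rescaled to one half of it. It is a
left inverse of `halfSplit`, and a right inverse except at the endpoint shared by the two halves. -/
noncomputable def halfJoin (q : Bool × I) : I :=
  ⟨(cond q.1 1 0 + (q.2 : ℝ)) / 2, by
    obtain ⟨b, t, h0, h1⟩ := q
    cases b <;> constructor <;> simp <;> linarith⟩

open unitInterval in
/-- The splitting of the unit interval into two halves, each of them rescaled to the unit
interval. -/
noncomputable def halfSplit (x : I) : Bool × I :=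
  if h : (x : ℝ) < 1 / 2 then (false, ⟨2 * x, by have := x.2.1; linarith, by linarith⟩)
  else (true, ⟨2 * x - 1, by linarith, by have := x.2.2; linarith⟩)

open unitInterval

theorem halfSplit_of_lt {x : I} (h : (x : ℝ) < 1 / 2) :
    halfSplit x = (false, ⟨2 * x, by have := x.2.1; linarith, by linarith⟩) := dif_pos h

theorem halfSplit_of_not_lt {x : I} (h : ¬ (x : ℝ) < 1 / 2) :
    halfSplit x = (true, ⟨2 * x - 1, by linarith, by have := x.2.2; linarith⟩) := dif_neg h

theorem halfJoin_halfSplit (x : I) : halfJoin (halfSplit x) = x := by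
  ext
  by_cases h : (x : ℝ) < 1 / 2
  · simp [halfSplit_of_lt h, halfJoin]
  · simp [halfSplit_of_not_lt h, halfJoin]

theorem halfSplit_halfJoin (q : Bool × I) (hq : q.2 ≠ 1) : halfSplit (halfJoin q) = q := by
  obtain ⟨b, t, h0, h1⟩ := q
  have ht : t < 1 := lt_of_le_of_ne h1 fun h => hq (Subtype.ext h)
  cases b
  · have h : ((halfJoin (false, ⟨t, h0, h1⟩) : I) : ℝ) < 1 / 2 := by
      simp only [halfJoin, cond_false]; linarith
    rw [halfSplit_of_lt h]
    refine Prod.ext rfl (Subtype.ext ?_)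
    simp only [halfJoin, cond_false]
    ring
  · have h : ¬ ((halfJoin (true, ⟨t, h0, h1⟩) : I) : ℝ) < 1 / 2 := by
      simp only [halfJoin, cond_true]; linarith
    rw [halfSplit_of_not_lt h]
    refine Prod.ext rfl (Subtype.ext ?_)
    simp only [halfJoin, cond_true]
    ring

theorem measurable_halfJoin : Measurable halfJoin := by
  refine Measurable.subtype_mk ?_
  have : Measurable fun b : Bool => (cond b 1 0 : ℝ) := measurable_of_countable _
  fun_prop

theorem measurable_halfSplit : Measurable halfSplit := by
  have hb : Measurable fun x : I => decide (¬ (x : ℝ) < 1 / 2) := by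
    refine measurable_to_bool ?_
    have : (fun x : I => decide (¬ (x : ℝ) < 1 / 2)) ⁻¹' {true} = {x : I | 1 / 2 ≤ (x : ℝ)} := by
      ext x; simp
    rw [this]
    exact measurableSet_le measurable_const measurable_subtype_coe
  have h1 : ∀ x, (halfSplit x).1 = decide (¬ (x : ℝ) < 1 / 2) := fun x => by
    by_cases h : (x : ℝ) < 1 / 2
    · rw [halfSplit_of_lt h]; exact (decide_eq_false (not_not.2 h)).symm
    · rw [halfSplit_of_not_lt h]; exact (decide_eq_true h).symm
  have h2 : ∀ x, ((halfSplit x).2 : ℝ) = if (x : ℝ) < 1 / 2 then 2 * (x : ℝ) else 2 * x - 1 :=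
    fun x => by
      by_cases h : (x : ℝ) < 1 / 2
      · rw [halfSplit_of_lt h, if_pos h]
      · rw [halfSplit_of_not_lt h, if_neg h]
  refine Measurable.prod ?_ ?_
  · rw [funext h1]; exact hb
  · refine Measurable.subtype_mk (f := fun x => ((halfSplit x).2 : ℝ)) ?_
    rw [funext h2]
    exact Measurable.ite (measurableSet_lt measurable_subtype_coe measurable_const)
      (measurable_subtype_coe.const_mul _) ((measurable_subtype_coe.const_mul _).sub_const _)

theorem measurePreserving_halfJoin :
    MeasurePreserving halfJoin (fairCoin.prod volume) volume := by
  refine ⟨measurable_halfJoin, ?_⟩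
  have : IsProbabilityMeasure ((fairCoin.prod (volume : Measure I)).map halfJoin) :=
    Measure.isProbabilityMeasure_map measurable_halfJoin.aemeasurable
  refine Measure.ext_of_Iic _ _ fun x => ?_
  rw [Measure.map_apply measurable_halfJoin measurableSet_Iic,
    Measure.prod_apply (measurable_halfJoin measurableSet_Iic), fairCoin, lintegral_smul_measure,
    lintegral_count, tsum_bool, unitInterval.volume_Iic, smul_eq_mul]
  have e0 : Prod.mk false ⁻¹' (halfJoin ⁻¹' Set.Iic x) = {t : I | (t : ℝ) ≤ 2 * x} := by
    ext t
    simp only [Set.mem_preimage, Set.mem_Iic, halfJoin, Set.mem_ofPred_eq, ← Subtype.coe_le_coe]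
    constructor <;> intro h <;> simp at * <;> linarith
  have e1 : Prod.mk true ⁻¹' (halfJoin ⁻¹' Set.Iic x) = {t : I | (t : ℝ) ≤ 2 * x - 1} := by
    ext t
    simp only [Set.mem_preimage, Set.mem_Iic, halfJoin, Set.mem_ofPred_eq, ← Subtype.coe_le_coe]
    constructor <;> intro h <;> simp at * <;> linarith
  rw [e0, e1]
  obtain ⟨x, hx0, hx1⟩ := x
  have h2 : (2⁻¹ : ENNReal) = ENNReal.ofReal 2⁻¹ := by
    rw [ENNReal.ofReal_inv_of_pos two_pos]; simp
  rcases le_total x (1 / 2) with h | h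
  · have i0 : {t : I | (t : ℝ) ≤ 2 * x} = Set.Iic ⟨2 * x, by linarith, by linarith⟩ := by
      ext t; simp [← Subtype.coe_le_coe]
    have i1 : volume {t : I | (t : ℝ) ≤ 2 * x - 1} = 0 := by
      refine measure_mono_null (t := Set.Iic 0) (fun t ht => ?_) (by simp [unitInterval.volume_Iic])
      simp only [Set.mem_ofPred_eq] at ht
      rw [Set.mem_Iic, ← Subtype.coe_le_coe]
      simp only [Set.Icc.coe_zero]
      linarith
    simp only
    rw [i0, i1, unitInterval.volume_Iic, add_zero, h2, ← ENNReal.ofReal_mul (by norm_num)]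
    congr 1
    simp
  · have i0 : {t : I | (t : ℝ) ≤ 2 * x} = Set.univ := by
      ext t
      have := t.2.2
      simp only [Set.mem_ofPred_eq, Set.mem_univ, iff_true]
      linarith
    have i1 : {t : I | (t : ℝ) ≤ 2 * x - 1} = Set.Iic ⟨2 * x - 1, by linarith, by linarith⟩ := by
      ext t; simp [← Subtype.coe_le_coe]
    simp only
    rw [i0, i1, unitInterval.volume_Iic, measure_univ, h2, ← ENNReal.ofReal_one,
      ← ENNReal.ofReal_add (by norm_num) (by simp; linarith), ← ENNReal.ofReal_mul (by norm_num)]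
    congr 1
    simp

theorem measurePreserving_halfSplit :
    MeasurePreserving halfSplit volume (fairCoin.prod volume) := by
  refine ⟨measurable_halfSplit, ?_⟩
  conv_lhs => rw [← measurePreserving_halfJoin.map_eq]
  rw [Measure.map_map measurable_halfSplit measurable_halfJoin]
  have h1 : ∀ᵐ q ∂(fairCoin.prod (volume : Measure I)), q.2 ≠ 1 := by
    have : ∀ᵐ t ∂(volume : Measure I), t ≠ 1 := by
      simp [ae_iff]
    exact Measure.quasiMeasurePreserving_snd.ae this
  have h2 : halfSplit ∘ halfJoin =ᵐ[fairCoin.prod volume] id :=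
    h1.mono fun q hq => halfSplit_halfJoin q hq
  rw [Measure.map_congr h2, Measure.map_id]

/-- The binary digits of a uniformly distributed number are independent fair coins: the splitting
removes one digit, far enough in the expansion. -/
theorem hasFineSplitting_unitInterval : HasFineSplitting (volume : Measure I) := by
  have key : ∀ m : ℕ, ∃ R : I → I × Bool, MeasurePreserving R volume (volume.prod fairCoin) ∧
      ∀ x, dist (R x).1 x ≤ (1 / 2) ^ m := by
    intro m
    induction m with
    | zero =>
      refine ⟨_, Measure.measurePreserving_swap.comp measurePreserving_halfSplit, fun x => ?_⟩
      rw [pow_zero, Subtype.dist_eq, Real.dist_eq, abs_le]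
      have h1 := (Prod.swap (halfSplit x)).1.2
      have h2 := x.2
      constructor <;> simp only [Function.comp] <;> linarith [h1.1, h1.2, h2.1, h2.2]
    | succ m ih =>
      obtain ⟨R, hR, hd⟩ := ih
      have h1 : MeasurePreserving (Prod.map id R) (fairCoin.prod volume)
          (fairCoin.prod (volume.prod fairCoin)) := (MeasurePreserving.id _).prod hR
      have h2 := (measurePreserving_prodAssoc fairCoin (volume : Measure I) fairCoin).symm
        MeasurableEquiv.prodAssoc
      have h3 : MeasurePreserving (Prod.map halfJoin id)
          ((fairCoin.prod (volume : Measure I)).prod fairCoin) (volume.prod fairCoin) :=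
        measurePreserving_halfJoin.prod (MeasurePreserving.id _)
      -- The first digit is kept, and the splitting given by induction acts on the following ones.
      refine ⟨_, h3.comp (h2.comp (h1.comp measurePreserving_halfSplit)), fun x => ?_⟩
      change dist (halfJoin ((halfSplit x).1, (R (halfSplit x).2).1)) x ≤ _
      have := hd (halfSplit x).2
      have hx : (x : ℝ) = (cond (halfSplit x).1 1 0 + ((halfSplit x).2 : ℝ)) / 2 :=
        congrArg Subtype.val (halfJoin_halfSplit x).symm
      rw [Subtype.dist_eq, Real.dist_eq] at this ⊢
      rw [hx]
      simp only [halfJoin]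
      rw [← sub_div, add_sub_add_left_eq_sub, abs_div, abs_two, pow_succ]
      linarith
  intro ε hε
  obtain ⟨m, hm⟩ := exists_pow_lt_of_lt_one hε (by norm_num : (1 / 2 : ℝ) < 1)
  obtain ⟨R, hR, hd⟩ := key m
  exact ⟨R, hR, fun x => (hd x).trans hm.le⟩

end FairCoin

/-! ### Optimal plans obtained from a potential -/

section Potentials

theorem IsTransportPlan.isProbabilityMeasure {M N : Type*} [MeasurableSpace M] [MeasurableSpace N]
    {μ : Measure M} {ν : Measure N} [IsProbabilityMeasure μ] {γ : Measure (M × N)}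
    (h : IsTransportPlan μ ν γ) :
    IsProbabilityMeasure γ := by
  refine ⟨?_⟩
  rw [← Set.preimage_univ (f := Prod.fst), ← Measure.map_apply measurable_fst MeasurableSet.univ,
    h.1, measure_univ]

variable {X M N : Type*} [MetricSpace X] [CompactSpace X] [MeasurableSpace X] [BorelSpace X]
  [TopologicalSpace M] [T2Space M] [CompactSpace M] [SecondCountableTopology M]
  [MeasurableSpace M] [BorelSpace M]
  [TopologicalSpace N] [T2Space N] [CompactSpace N] [SecondCountableTopology N]
  [MeasurableSpace N] [BorelSpace N]

/-- The easy half of Kantorovich duality, with its equality case: if the inequality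
`u x + v y ≤ c (x, y)` holds for `ν`-almost every `y`, and is an equality only for `x = S y`, then a
plan whose cost is at most `∫ u dμ + ∫ v dν` is carried by the graph of `S`. -/
theorem IsTransportPlan.le_integral_and_eq {μ : Measure M} {ν : Measure N}
    [IsProbabilityMeasure μ] [IsProbabilityMeasure ν] {c : M × N → ℝ} (hc : Continuous c)
    {u : M → ℝ} (hu : Measurable u) {C : ℝ} (huC : ∀ x, |u x| ≤ C) {v : N → ℝ} (hv : Measurable v)
    {C' : ℝ} (hvC : ∀ y, |v y| ≤ C') {S : N → M} (hS : Measurable S)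
    (hle : ∀ᵐ y ∂ν, ∀ x, u x + v y ≤ c (x, y) ∧ (u x + v y = c (x, y) → x = S y))
    {γ : Measure (M × N)} (h : IsTransportPlan μ ν γ) :
    ∫ x, u x ∂μ + ∫ y, v y ∂ν ≤ ∫ p, c p ∂γ ∧
      (∫ p, c p ∂γ ≤ ∫ x, u x ∂μ + ∫ y, v y ∂ν → γ = ν.map fun y => (S y, y)) := by
  have := h.isProbabilityMeasure
  have hcint : Integrable c γ :=
    hc.integrable_of_hasCompactSupport (HasCompactSupport.of_compactSpace c)
  have hu' : Integrable (fun p : M × N => u p.1) γ := Integrable.of_bound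
    (hu.comp measurable_fst).aestronglyMeasurable C (Filter.Eventually.of_forall fun p => huC p.1)
  have hv' : Integrable (fun p : M × N => v p.2) γ := Integrable.of_bound
    (hv.comp measurable_snd).aestronglyMeasurable C' (Filter.Eventually.of_forall fun p => hvC p.2)
  have hJ : ∫ x, u x ∂μ + ∫ y, v y ∂ν = ∫ p, (u p.1 + v p.2) ∂γ := by
    rw [integral_add hu' hv', ← h.1, ← h.2,
      integral_map measurable_fst.aemeasurable hu.aestronglyMeasurable,
      integral_map measurable_snd.aemeasurable hv.aestronglyMeasurable]
  have hae : ∀ᵐ p ∂γ, ∀ x, u x + v p.2 ≤ c (x, p.2) ∧ (u x + v p.2 = c (x, p.2) → x = S p.2) := by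
    rw [← h.2] at hle
    exact ae_of_ae_map measurable_snd.aemeasurable hle
  have hnn : 0 ≤ᵐ[γ] fun p => c p - (u p.1 + v p.2) :=
    hae.mono fun p hp => sub_nonneg.2 (hp p.1).1
  have hsub : ∫ p, (c p - (u p.1 + v p.2)) ∂γ = ∫ p, c p ∂γ - ∫ p, (u p.1 + v p.2) ∂γ :=
    integral_sub hcint (hu'.add hv')
  refine ⟨?_, fun hle' => ?_⟩
  · have := integral_nonneg_of_ae hnn
    linarith
  · have h0 : ∫ p, (c p - (u p.1 + v p.2)) ∂γ = 0 :=
      le_antisymm (by linarith) (integral_nonneg_of_ae hnn)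
    rw [integral_eq_zero_iff_of_nonneg_ae hnn (hcint.sub (hu'.add hv'))] at h0
    have hgraph : ∀ᵐ p ∂γ, id p = (S p.2, p.2) := by
      filter_upwards [h0, hae] with p hp hp'
      have := (hp' p.1).2 (by simp only [Pi.zero_apply] at hp; linarith)
      exact Prod.ext this rfl
    calc γ = γ.map id := Measure.map_id.symm
      _ = γ.map fun p => (S p.2, p.2) := Measure.map_congr hgraph
      _ = (γ.map Prod.snd).map fun y => (S y, y) := by
        rw [Measure.map_map (g := fun y => (S y, y)) (hS.prodMk measurable_id) measurable_snd]; rfl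
      _ = _ := by rw [h.2]

/-- Half of the mass sitting at `ψ ξ` is sent to `a (ξ, false)`, and the other half to
`a (ξ, true)`. If `c (·, a q) - u` has a strict minimum at `ψ q.1` for each `q`, then this plan is
the unique optimal one, and its cost is the infimum in Monge's problem, which is not attained. -/
theorem exists_unique_optimalPlan_of_potential (ρ : Measure X) [IsProbabilityMeasure ρ]
    (hρ : HasFineSplitting ρ) {c : M × N → ℝ} (hc : Continuous c) {ψ : X → M} (hψ : Continuous ψ)
    (hψi : Function.Injective ψ) {a : X × Bool → N} (ha : Continuous a)
    (hai : Function.Injective a) {u : M → ℝ} (hu : Measurable u) {C : ℝ} (huC : ∀ x, |u x| ≤ C)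
    (hmin : ∀ (q : X × Bool) (x : M), x ≠ ψ q.1 →
      c (ψ q.1, a q) - u (ψ q.1) < c (x, a q) - u x) :
    (∃ γ : Measure (M × N), IsOptimalPlan c (ρ.map ψ) ((ρ.prod fairCoin).map a) γ ∧
      (∀ γ' : Measure (M × N), IsOptimalPlan c (ρ.map ψ) ((ρ.prod fairCoin).map a) γ' → γ' = γ) ∧
        ¬ IsSupportedOnGraph γ) ∧
      ¬ ∃ T : M → N, IsMongeSolution c (ρ.map ψ) ((ρ.prod fairCoin).map a) T := by
  set θ := ρ.prod fairCoin with hθ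
  have hψe : MeasurableEmbedding ψ := (hψ.isClosedEmbedding hψi).measurableEmbedding
  have hae : MeasurableEmbedding a := (ha.isClosedEmbedding hai).measurableEmbedding
  have hXne : Nonempty X := by
    by_contra h
    rw [not_nonempty_iff] at h
    have := measure_univ (μ := ρ)
    rw [Set.univ_eq_empty_iff.2 h, measure_empty] at this
    exact zero_ne_one this
  obtain ⟨ainv, hainv, hainv'⟩ := hae.exists_measurable_extend measurable_id
    (fun _ => (inferInstance : Nonempty (X × Bool)))
  obtain ⟨ψinv, hψinv, hψinv'⟩ := hψe.exists_measurable_extend measurable_id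
    (fun _ => (inferInstance : Nonempty X))
  replace hainv' : ∀ q, ainv (a q) = q := congrFun hainv'
  replace hψinv' : ∀ ξ, ψinv (ψ ξ) = ξ := congrFun hψinv'
  set μ := ρ.map ψ with hμ
  set ν := θ.map a with hν
  have : IsProbabilityMeasure μ := Measure.isProbabilityMeasure_map hψe.measurable.aemeasurable
  have : IsProbabilityMeasure ν := Measure.isProbabilityMeasure_map hae.measurable.aemeasurable
  set S : N → M := fun y => ψ (ainv y).1 with hSdef
  have hS : Measurable S := hψe.measurable.comp (measurable_fst.comp hainv)
  -- The dual potential of `u`: on the range of `a`, it is the minimum of `c (·, y) - u`.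
  set v : N → ℝ := fun y => c (S y, y) - u (S y) with hvdef
  have hv : Measurable v := (hc.measurable.comp (hS.prodMk measurable_id)).sub (hu.comp hS)
  obtain ⟨B, hB⟩ := (isCompact_range hc).isBounded.exists_norm_le
  have hcB : ∀ p, |c p| ≤ B := fun p => hB _ ⟨p, rfl⟩
  have hvB : ∀ y, |v y| ≤ B + C := fun y =>
    (abs_sub _ _).trans (add_le_add (hcB _) (huC _))
  have hSa : ∀ q, S (a q) = ψ q.1 := fun q => by simp only [hSdef, hainv']
  have hle : ∀ᵐ y ∂ν, ∀ x, u x + v y ≤ c (x, y) ∧ (u x + v y = c (x, y) → x = S y) := by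
    have hr : ∀ᵐ y ∂ν, y ∈ Set.range a :=
      (ae_map_mem_range a hae.measurableSet_range θ)
    filter_upwards [hr] with y hy x
    obtain ⟨q, rfl⟩ := hy
    simp only [hvdef, hSa]
    by_cases hx : x = ψ q.1
    · subst hx
      exact ⟨by linarith, fun _ => rfl⟩
    · have := hmin q x hx
      exact ⟨by linarith, fun h => by linarith⟩
  set J := ∫ x, u x ∂μ + ∫ y, v y ∂ν with hJ
  have hdual : ∀ {γ' : Measure (M × N)}, IsTransportPlan μ ν γ' → J ≤ ∫ p, c p ∂γ' ∧
      (∫ p, c p ∂γ' ≤ J → γ' = ν.map fun y => (S y, y)) := fun h =>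
    h.le_integral_and_eq hc hu huC hv hvB hS hle
  have hg : Measurable fun y => (S y, y) := hS.prodMk measurable_id
  set γ := ν.map fun y => (S y, y) with hγ
  have hplan : IsTransportPlan μ ν γ := by
    constructor
    · rw [hγ, Measure.map_map measurable_fst hg, hν,
        Measure.map_map (measurable_fst.comp hg) hae.measurable, hμ]
      have : (Prod.fst ∘ fun y => (S y, y)) ∘ a = ψ ∘ Prod.fst := by
        ext q; exact hSa q
      rw [this, ← Measure.map_map hψe.measurable measurable_fst, hθ,
        measurePreserving_fst.map_eq]
    · rw [hγ, Measure.map_map measurable_snd hg]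
      exact Measure.map_id
  have hcost : ∫ p, c p ∂γ = J := by
    rw [hJ, hγ, integral_map hg.aemeasurable hc.aestronglyMeasurable]
    have h1 : ∫ x, u x ∂μ = ∫ y, u (S y) ∂ν := by
      have : μ = ν.map S := by
        rw [← hplan.1, hγ, Measure.map_map measurable_fst hg]; rfl
      rw [this, integral_map hS.aemeasurable hu.aestronglyMeasurable]
    rw [h1, ← integral_add]
    · simp [hvdef]
    · exact Integrable.of_bound (hu.comp hS).aestronglyMeasurable C
        (Filter.Eventually.of_forall fun y => huC _)
    · exact Integrable.of_bound hv.aestronglyMeasurable _ (Filter.Eventually.of_forall hvB)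
  have hgraph : ¬ IsSupportedOnGraph γ := by
    rintro ⟨T, hT⟩
    have h1 : ∀ᵐ q ∂θ, a q = T (ψ q.1) := by
      have := ae_of_ae_map hae.measurable.aemeasurable (ae_of_ae_map hg.aemeasurable hT)
      simpa only [hSa] using this
    have h2 := Measure.ae_ae_of_ae_prod h1
    obtain ⟨ξ, hξ⟩ := h2.exists
    rw [ae_fairCoin_iff] at hξ
    have := hai ((hξ true).trans (hξ false).symm)
    simp at this
  refine ⟨⟨γ, ⟨hplan, fun γ' h => hcost.le.trans (hdual h).1⟩, fun γ' h => ?_, hgraph⟩, ?_⟩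
  · exact (hdual h.1).2 ((h.2 γ hplan).trans hcost.le)
  rintro ⟨T, ⟨hTm, hTν⟩, hTmin⟩
  have hTg : Measurable fun x => (x, T x) := measurable_id.prodMk hTm
  have hTplan : IsTransportPlan μ ν (μ.map fun x => (x, T x)) := by
    constructor
    · rw [Measure.map_map measurable_fst hTg]
      exact Measure.map_id
    · rw [Measure.map_map measurable_snd hTg]
      exact hTν
  have hTcost : ∫ p, c p ∂(μ.map fun x => (x, T x)) = ∫ x, c (x, T x) ∂μ :=
    integral_map hTg.aemeasurable hc.aestronglyMeasurable
  -- Maps which follow a fine splitting of `ρ` have a cost close to that of the optimal plan.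
  have happrox : ∀ ε > 0, ∃ T' : M → N, IsTransportMap μ ν T' ∧ ∫ x, c (x, T' x) ∂μ ≤ J + ε := by
    intro ε hε
    have hcont : ∀ b, Continuous fun z : X × X => c (ψ z.1, a (z.2, b)) := fun b => by fun_prop
    have huc := fun b => Metric.uniformContinuous_iff.1
      (CompactSpace.uniformContinuous_of_continuous (hcont b)) ε hε
    choose δ' hδ' hδ using huc
    set δ := min (δ' true) (δ' false)
    have hδ0 : 0 < δ := lt_min (hδ' _) (hδ' _)
    have hδle : ∀ b, δ ≤ δ' b := fun b => by
      cases b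
      · exact min_le_right _ _
      · exact min_le_left _ _
    obtain ⟨R, hR, hRd⟩ := hρ (δ / 2) (by positivity)
    have hT' : Measurable fun x => a (R (ψinv x)) :=
      hae.measurable.comp (hR.measurable.comp hψinv)
    refine ⟨fun x => a (R (ψinv x)), ⟨hT', ?_⟩, ?_⟩
    · rw [hμ, Measure.map_map hT' hψe.measurable, hν, hθ, ← hR.map_eq,
        Measure.map_map hae.measurable hR.measurable]
      congr 1
      ext ξ
      simp [hψinv']
    · have e1 : ∫ x, c (x, a (R (ψinv x))) ∂μ = ∫ ξ, c (ψ ξ, a (R ξ)) ∂ρ := by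
        have hm : Measurable fun x => c (x, a (R (ψinv x))) :=
          hc.measurable.comp (measurable_id.prodMk hT')
        rw [hμ, integral_map hψe.measurable.aemeasurable hm.aestronglyMeasurable]
        simp only [hψinv']
      have e2 : J = ∫ ξ, c (ψ (R ξ).1, a (R ξ)) ∂ρ := by
        have hm : Measurable fun q => c (ψ q.1, a q) :=
          hc.measurable.comp ((hψe.measurable.comp measurable_fst).prodMk hae.measurable)
        have hm' : Measurable fun y => c (S y, y) := hc.measurable.comp hg
        rw [← hcost, hγ, integral_map hg.aemeasurable hc.aestronglyMeasurable, hν,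
          integral_map hae.measurable.aemeasurable hm'.aestronglyMeasurable]
        simp only [hSa]
        rw [hθ, ← hR.map_eq, integral_map hR.measurable.aemeasurable hm.aestronglyMeasurable]
      have hm1 : Measurable fun ξ => c (ψ ξ, a (R ξ)) :=
        hc.measurable.comp (hψe.measurable.prodMk (hae.measurable.comp hR.measurable))
      have hm2 : Measurable fun ξ => c (ψ (R ξ).1, a (R ξ)) := hc.measurable.comp
        ((hψe.measurable.comp (measurable_fst.comp hR.measurable)).prodMk
          (hae.measurable.comp hR.measurable))
      have i1 : Integrable (fun ξ => c (ψ ξ, a (R ξ))) ρ := Integrable.of_bound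
        hm1.aestronglyMeasurable B (Filter.Eventually.of_forall fun ξ => hcB _)
      have i2 : Integrable (fun ξ => c (ψ (R ξ).1, a (R ξ))) ρ := Integrable.of_bound
        hm2.aestronglyMeasurable B (Filter.Eventually.of_forall fun ξ => hcB _)
      rw [e1, e2]
      calc ∫ ξ, c (ψ ξ, a (R ξ)) ∂ρ ≤ ∫ ξ, (c (ψ (R ξ).1, a (R ξ)) + ε) ∂ρ := by
            refine integral_mono i1 (i2.add (integrable_const ε)) fun ξ => ?_
            have hd : dist (ξ, (R ξ).1) ((R ξ).1, (R ξ).1) < δ' (R ξ).2 := by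
              rw [Prod.dist_eq, dist_self, max_eq_left dist_nonneg, dist_comm]
              linarith [hRd ξ, hδle (R ξ).2]
            have := hδ _ hd
            rw [Real.dist_eq, abs_lt] at this
            simp only at this ⊢
            linarith
        _ = ∫ ξ, c (ψ (R ξ).1, a (R ξ)) ∂ρ + ε := by
            rw [integral_add i2 (integrable_const ε)]; simp
  -- A solution of Monge's problem thus induces an optimal plan, which must be `γ`.
  have hTJ : ∫ x, c (x, T x) ∂μ ≤ J := by
    refine le_of_forall_pos_le_add fun ε hε => ?_
    obtain ⟨T', hT', h⟩ := happrox ε hε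
    exact (hTmin T' hT').trans h
  have hTγ : (μ.map fun x => (x, T x)) = γ := (hdual hTplan).2 (hTcost.le.trans hTJ)
  refine hgraph ⟨T, ?_⟩
  rw [← hTγ, ae_map_iff hTg.aemeasurable
    (show MeasurableSet {p : M × N | p.2 = T p.1} from
      measurableSet_eq_fun measurable_snd (hTm.comp measurable_fst))]
  exact Filter.Eventually.of_forall fun x => rfl

end Potentials

/-! ### Concave potentials near a point with invertible mixed Hessian -/

section LocalPotential

variable {E : Type*} [NormedAddCommGroup E] [InnerProductSpace ℝ E] [FiniteDimensional ℝ E]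

/-- The partial differential in the first variable of a function on a product of vector spaces. -/
noncomputable def fderivFst (C : E × E → ℝ) (z : E × E) : E →L[ℝ] ℝ :=
  (fderiv ℝ C z).comp (ContinuousLinearMap.inl ℝ E E)

omit [FiniteDimensional ℝ E] in
theorem ContDiffAt.fderivFst {C : E × E → ℝ} {z : E × E} (hC : ContDiffAt ℝ 2 C z) :
    ContDiffAt ℝ 1 (fderivFst C) z :=
  (hC.fderiv_right (m := 1) (by norm_num)).clm_comp contDiffAt_const

omit [FiniteDimensional ℝ E] in
theorem hasFDerivAt_fderivFst {C : E × E → ℝ} {ξ η : E} (hC : DifferentiableAt ℝ C (ξ, η)) :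
    HasFDerivAt (fun ξ => C (ξ, η)) (fderivFst C (ξ, η)) ξ :=
  hC.hasFDerivAt.comp ξ (hasFDerivAt_prodMk_left ξ η)

/-- Where the mixed second derivative of `C` is invertible, the very concave function
`w ξ = p ξ - K ‖ξ - ξ₀‖ ^ 2` is a potential for which the points `ξ` near `ξ₀` are matched to the
solutions `η = Y ξ` of `∂C/∂ξ (ξ, η) = Dw (ξ)`: the function `C (·, Y ξ) - w` has a strict minimum at
`ξ`. Since `w` is so concave, `ξ` is a Lipschitz function of `Y ξ`. -/
theorem exists_localPotential {C : E × E → ℝ} {ξ₀ η₀ : E} (hC : ContDiffAt ℝ 2 C (ξ₀, η₀))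
    (hinv : Function.Bijective fun v => fderiv ℝ (fderivFst C) (ξ₀, η₀) (0, v)) :
    ∃ A > 0, ∃ ρ₀ > 0, ∀ K ≥ A, ∀ U ∈ 𝓝 η₀, ∃ r > 0, ∃ Y : E → E,
      ContinuousOn Y (Metric.ball ξ₀ r) ∧ Set.MapsTo Y (Metric.ball ξ₀ r) U ∧
      (∀ ξ ∈ Metric.ball ξ₀ r, ∀ ξ' ∈ Metric.ball ξ₀ ρ₀,
        C (ξ, Y ξ) - (fderivFst C (ξ₀, η₀) ξ - K * ‖ξ - ξ₀‖ ^ 2) + ‖ξ' - ξ‖ ^ 2 ≤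
          C (ξ', Y ξ) - (fderivFst C (ξ₀, η₀) ξ' - K * ‖ξ' - ξ₀‖ ^ 2)) ∧
      ∀ ξ ∈ Metric.ball ξ₀ r, ∀ ξ' ∈ Metric.ball ξ₀ r, ‖ξ - ξ'‖ ≤ A * ‖Y ξ - Y ξ'‖ := by
  set g := fderivFst C with hg
  have hg1 : ContDiffAt ℝ 1 g (ξ₀, η₀) := hC.fderivFst
  obtain ⟨κ, t, ht, hlip⟩ := hg1.exists_lipschitzOnWith
  have hdiff : ∀ᶠ z in 𝓝 (ξ₀, η₀), DifferentiableAt ℝ C z :=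
    (hC.eventually (by simp)).mono fun z hz => hz.differentiableAt two_ne_zero
  obtain ⟨ρ₀, hρ₀, hball⟩ := Metric.mem_nhds_iff.1 (Filter.inter_mem ht hdiff)
  have hmem : ∀ ξ ∈ Metric.ball ξ₀ ρ₀, ∀ η ∈ Metric.ball η₀ ρ₀,
      (ξ, η) ∈ t ∧ DifferentiableAt ℝ C (ξ, η) := fun ξ hξ η hη => hball <| by
    rw [← ball_prod_same]; exact ⟨hξ, hη⟩
  refine ⟨κ + 1, by positivity, ρ₀, hρ₀, fun K hK U hU => ?_⟩
  have hκ : (0 : ℝ) ≤ κ := κ.2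
  have hK0 : 0 < K := by linarith
  set p := g (ξ₀, η₀) with hp
  -- The equation `∂C/∂ξ (ξ, η) = Dw (ξ)` reads `G (ξ, η) = G (ξ₀, η₀)`.
  set L : E × E →L[ℝ] (E →L[ℝ] ℝ) :=
    (2 * K) • (innerSL ℝ).comp (ContinuousLinearMap.fst ℝ E E) with hL
  set G : E × E → (E →L[ℝ] ℝ) := fun z => g z + L (z - (ξ₀, η₀)) with hG
  have hGs : HasStrictFDerivAt G (fderiv ℝ g (ξ₀, η₀) + L) (ξ₀, η₀) := by
    refine (hg1.hasStrictFDerivAt one_ne_zero).add ?_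
    exact L.hasStrictFDerivAt.comp (ξ₀, η₀) ((hasStrictFDerivAt_id _).sub_const _)
  have hinr : ∀ v, ((fderiv ℝ g (ξ₀, η₀) + L).comp (ContinuousLinearMap.inr ℝ E E)) v =
      fderiv ℝ g (ξ₀, η₀) (0, v) := fun v => by simp [hL]
  have hinv' : ((fderiv ℝ g (ξ₀, η₀) + L).comp (ContinuousLinearMap.inr ℝ E E)).IsInvertible := by
    rw [← funext hinr] at hinv
    exact ⟨(LinearEquiv.ofBijective ((fderiv ℝ g (ξ₀, η₀) + L).comp
      (ContinuousLinearMap.inr ℝ E E) : E →ₗ[ℝ] (E →L[ℝ] ℝ)) hinv).toContinuousLinearEquiv, by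
        ext v; rfl⟩
  set Y := hGs.implicitFunctionOfProdDomain hinv' with hY
  obtain ⟨κ', s, hs, hYlip⟩ :=
    (hGs.hasStrictFDerivAt_implicitFunctionOfProdDomain hinv').exists_lipschitzOnWith
  have hYt := hGs.tendsto_implicitFunctionOfProdDomain hinv'
  have hYe := hGs.eventually_apply_implicitFunctionOfProdDomain hinv'
  obtain ⟨r, hr, hrs⟩ := Metric.mem_nhds_iff.1 (Filter.inter_mem (Filter.inter_mem hs
    (Metric.ball_mem_nhds ξ₀ hρ₀)) (Filter.inter_mem
      (hYt (Filter.inter_mem hU (Metric.ball_mem_nhds η₀ hρ₀))) hYe))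
  have heq : ∀ ξ ∈ Metric.ball ξ₀ r, ∀ v,
      g (ξ, Y ξ) v = p v - 2 * K * inner ℝ (ξ - ξ₀) v := by
    intro ξ hξ v
    have h : G (ξ, Y ξ) = G (ξ₀, η₀) := (hrs hξ).2.2
    have := congrArg (fun l => l v) h
    have h0 : G (ξ₀, η₀) = p := by simp [hG, hp]
    rw [h0] at this
    simp only [hG, hL, add_apply,
      smul_apply, ContinuousLinearMap.comp_apply,
      ContinuousLinearMap.coe_fst', Prod.fst_sub, innerSL_apply_apply, smul_eq_mul] at this
    linarith
  refine ⟨r, hr, Y, (hYlip.mono fun ξ hξ => (hrs hξ).1.1).continuousOn,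
    fun ξ hξ => (hrs hξ).2.1.1, ?_, ?_⟩
  · intro ξ hξ ξ' hξ'
    have hξρ : ξ ∈ Metric.ball ξ₀ ρ₀ := (hrs hξ).1.2
    have hη : Y ξ ∈ Metric.ball η₀ ρ₀ := (hrs hξ).2.1.2
    have hseg : segment ℝ ξ ξ' ⊆ Metric.ball ξ₀ ρ₀ := (convex_ball ξ₀ ρ₀).segment_subset hξρ hξ'
    -- As `g` is `κ`-Lipschitz, `C (·, Y ξ)` lies above its linearization at `ξ` minus
    -- `κ ‖ξ' - ξ‖ ^ 2`, and `-w` lies above its own by `K ‖ξ' - ξ‖ ^ 2`, with `K ≥ κ + 1`.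
    have hmv := (convex_segment ξ ξ').norm_image_sub_le_of_norm_hasFDerivWithin_le'
      (f := fun x => C (x, Y ξ)) (f' := fun x => g (x, Y ξ)) (φ := g (ξ, Y ξ))
      (C := κ * ‖ξ' - ξ‖)
      (fun x hx => (hasFDerivAt_fderivFst (hmem x (hseg hx) _ hη).2).hasFDerivWithinAt)
      (fun x hx => by
        refine (hlip.norm_sub_le (hmem x (hseg hx) _ hη).1 (hmem ξ hξρ _ hη).1).trans ?_
        rw [Prod.mk_sub_mk, sub_self, Prod.norm_mk, norm_zero, max_eq_left (norm_nonneg _)]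
        refine mul_le_mul_of_nonneg_left ?_ hκ
        rw [← dist_eq_norm, ← dist_eq_norm]
        have := dist_add_dist_of_mem_segment hx
        rw [dist_comm x ξ, dist_comm ξ' ξ]
        linarith [dist_nonneg (x := x) (y := ξ')])
      (left_mem_segment ℝ ξ ξ') (right_mem_segment ℝ ξ ξ')
    rw [Real.norm_eq_abs, abs_le] at hmv
    have h1 := hmv.1
    rw [heq ξ hξ (ξ' - ξ)] at h1
    have h2 : ‖ξ' - ξ₀‖ ^ 2 = ‖ξ - ξ₀‖ ^ 2 + 2 * inner ℝ (ξ - ξ₀) (ξ' - ξ) + ‖ξ' - ξ‖ ^ 2 := by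
      rw [← norm_add_sq_real]
      congr 2
      abel
    rw [map_sub] at h1
    rw [h2]
    nlinarith [mul_nonneg (by linarith : 0 ≤ K - (κ + 1)) (sq_nonneg ‖ξ' - ξ‖)]
  · -- The difference `2 K ‖ξ - ξ'‖` of the gradients of `w` is at most
    -- `κ (‖ξ - ξ'‖ + ‖Y ξ - Y ξ'‖)`, and the first term is absorbed.
    intro ξ hξ ξ' hξ'
    have h1 : g (ξ, Y ξ) - g (ξ', Y ξ') = -((2 * K) • innerSL ℝ (ξ - ξ')) := by
      ext v
      simp only [sub_apply, heq ξ hξ, heq ξ' hξ',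
        neg_apply, smul_apply, innerSL_apply_apply,
        smul_eq_mul, inner_sub_left]
      ring
    have h2 := hlip.norm_sub_le (hmem ξ (hrs hξ).1.2 _ (hrs hξ).2.1.2).1
      (hmem ξ' (hrs hξ').1.2 _ (hrs hξ').2.1.2).1
    rw [h1, norm_neg, norm_smul, innerSL_apply_norm, Real.norm_of_nonneg (by positivity),
      Prod.mk_sub_mk, Prod.norm_mk] at h2
    have h3 : max ‖ξ - ξ'‖ ‖Y ξ - Y ξ'‖ ≤ ‖ξ - ξ'‖ + ‖Y ξ - Y ξ'‖ :=
      max_le_add_of_nonneg (norm_nonneg _) (norm_nonneg _)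
    have h4 := h2.trans (mul_le_mul_of_nonneg_left h3 hκ)
    nlinarith [norm_nonneg (ξ - ξ'), norm_nonneg (Y ξ - Y ξ'),
      mul_nonneg (by linarith : 0 ≤ K - (κ + 1)) (norm_nonneg (ξ - ξ')),
      mul_nonneg hκ (norm_nonneg (ξ - ξ'))]

end LocalPotential

/-! ### A parametrized small cube -/

section Cube

open unitInterval

/-- The embedding of a small cube with corner `ξ₀` into `ℝ^(m+1)`. The first coordinate is kept
separate, as it is the one along which the cube is split. -/
noncomputable def cubeMap {m : ℕ} (ξ₀ : EuclideanSpace ℝ (Fin (m + 1))) (r : ℝ)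
    (x : I × (Fin m → I)) : EuclideanSpace ℝ (Fin (m + 1)) :=
  ξ₀ + r • WithLp.toLp 2 (fun i => ((Fin.cons x.1 x.2 : Fin (m + 1) → I) i : ℝ))

variable {m : ℕ} (ξ₀ : EuclideanSpace ℝ (Fin (m + 1)))

theorem continuous_cubeMap (r : ℝ) : Continuous (cubeMap ξ₀ r) := by
  refine continuous_const.add (Continuous.const_smul ?_ r)
  refine (PiLp.continuous_toLp 2 _).comp (continuous_pi fun i => continuous_subtype_val.comp ?_)
  refine Fin.cases ?_ (fun j => ?_) i
  · exact continuous_fst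
  · exact (continuous_apply j).comp continuous_snd

theorem injective_cubeMap {r : ℝ} (hr : r ≠ 0) : Function.Injective (cubeMap ξ₀ r) := by
  intro x y h
  have h1 := smul_right_injective _ hr (add_left_cancel h)
  have h2 : ∀ i, (Fin.cons x.1 x.2 : Fin (m + 1) → I) i = (Fin.cons y.1 y.2 : Fin (m + 1) → I) i :=
    fun i => Subtype.ext (congrFun (WithLp.toLp_injective 2 h1) i)
  exact Prod.ext (h2 0) (funext fun j => h2 j.succ)

theorem exists_cubeMap_mem_ball {ε : ℝ} (hε : 0 < ε) :
    ∃ r > 0, ∀ x : I × (Fin m → I), cubeMap ξ₀ r x ∈ Metric.ball ξ₀ ε := by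
  obtain ⟨B, hB⟩ := (isCompact_range (continuous_cubeMap (0 : EuclideanSpace ℝ (Fin (m + 1))) 1)
    ).isBounded.exists_norm_le
  have hB0 : 0 ≤ B := (norm_nonneg _).trans (hB _ ⟨(0, 0), rfl⟩)
  refine ⟨ε / (B + 1), by positivity, fun x => ?_⟩
  have hx := hB _ ⟨x, rfl⟩
  rw [cubeMap, zero_add, one_smul] at hx
  rw [mem_ball_iff_norm, cubeMap, add_sub_cancel_left, norm_smul,
    Real.norm_of_nonneg (by positivity), div_mul_eq_mul_div, div_lt_iff₀ (by positivity)]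
  exact mul_lt_mul_of_pos_left (by linarith) hε

theorem volume_cubeMap_preimage_eq_zero {r : ℝ} (hr : r ≠ 0)
    {Z : Set (EuclideanSpace ℝ (Fin (m + 1)))} (hZ : volume Z = 0) :
    (volume : Measure (I × (Fin m → I))) (cubeMap ξ₀ r ⁻¹' Z) = 0 := by
  have h1 : volume ((fun v : EuclideanSpace ℝ (Fin (m + 1)) => ξ₀ + r • v) ⁻¹' Z) = 0 := by
    have : (fun v : EuclideanSpace ℝ (Fin (m + 1)) => ξ₀ + r • v) ⁻¹' Z =
        (fun v => r • v) ⁻¹' ((fun v => ξ₀ + v) ⁻¹' Z) := rfl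
    rw [this, Measure.addHaar_preimage_smul _ hr, measure_preimage_add, hZ, mul_zero]
  have h2 := (EuclideanSpace.volume_preserving_symm_measurableEquiv_toLp
    (Fin (m + 1))).symm.quasiMeasurePreserving.preimage_null h1
  have h3 : Measure.QuasiMeasurePreserving
      (fun (z : Fin (m + 1) → I) i => ((z i : I) : ℝ)) volume volume := by
    have h := measurePreserving_pi (fun _ : Fin (m + 1) => (volume : Measure I))
      (fun _ => (volume : Measure ℝ).restrict I) (fun _ => unitInterval.measurePreserving_coe)
    have h' := Measure.restrict_pi_pi (fun _ : Fin (m + 1) => (volume : Measure ℝ)) (fun _ => I)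
    rw [← h'] at h
    exact h.quasiMeasurePreserving.mono_right Measure.restrict_le_self.absolutelyContinuous
  have h4 := (volume_preserving_piFinSuccAbove (fun _ : Fin (m + 1) => I) 0).symm
  have h5 := h4.quasiMeasurePreserving.preimage_null (h3.preimage_null h2)
  convert h5 using 2
  ext x
  have hx : (MeasurableEquiv.piFinSuccAbove (fun _ : Fin (m + 1) => I) 0).symm x =
      Fin.cons x.1 x.2 := by
    ext i
    simp [MeasurableEquiv.piFinSuccAbove, Fin.insertNthEquiv]
  simp only [Set.mem_preimage, cubeMap, hx]
  rfl

theorem volume_eq_zero_of_antilipschitzOn {n : ℕ}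
    {Y : EuclideanSpace ℝ (Fin n) → EuclideanSpace ℝ (Fin n)} {A : ℝ}
    {s : Set (EuclideanSpace ℝ (Fin n))}
    (hA : ∀ ξ ∈ s, ∀ ξ' ∈ s, ‖ξ - ξ'‖ ≤ A * ‖Y ξ - Y ξ'‖) (hs : volume (Y '' s) = 0) :
    volume s = 0 := by
  set H := Measure.hausdorffMeasure (X := EuclideanSpace ℝ (Fin n))
    (Module.finrank ℝ (EuclideanSpace ℝ (Fin n)))
  have h1 : H ≪ volume := Measure.absolutelyContinuous_isAddHaarMeasure _ _
  have h2 : volume ≪ H := Measure.absolutelyContinuous_isAddHaarMeasure _ _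
  refine h2 ?_
  have hinj : Set.InjOn Y s := fun ξ hξ ξ' hξ' h => by
    have := hA ξ hξ ξ' hξ'
    rw [h, sub_self, norm_zero, mul_zero] at this
    exact sub_eq_zero.1 (norm_le_zero_iff.1 this)
  have hlip : LipschitzOnWith A.toNNReal (Function.invFunOn Y s) (Y '' s) := by
    refine LipschitzOnWith.of_dist_le_mul ?_
    rintro _ ⟨ξ, hξ, rfl⟩ _ ⟨ξ', hξ', rfl⟩
    rw [hinj.leftInvOn_invFunOn hξ, hinj.leftInvOn_invFunOn hξ', dist_eq_norm, dist_eq_norm]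
    exact (hA ξ hξ ξ' hξ').trans
      (mul_le_mul_of_nonneg_right (Real.le_coe_toNNReal A) (norm_nonneg _))
  have h3 := hlip.hausdorffMeasure_image_le (d := Module.finrank ℝ (EuclideanSpace ℝ (Fin n)))
    (Nat.cast_nonneg _)
  rw [hinj.leftInvOn_invFunOn.image_image] at h3
  have h4 : H (Y '' s) = 0 := h1 hs
  exact nonpos_iff_eq_zero.1
    (h3.trans (by rw [show Measure.hausdorffMeasure _ (Y '' s) = 0 from h4, mul_zero]))

end Cube

/-! ### Costs in coordinates -/

section Coordinates

variable {n : ℕ} {M N : Type*} [TopologicalSpace M] [ChartedSpace (EuclideanSpace ℝ (Fin n)) M]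
  [TopologicalSpace N] [ChartedSpace (EuclideanSpace ℝ (Fin n)) N]

/-- The coordinate expression of a cost in the preferred charts at `x` and `y`. -/
noncomputable def costInCharts (c : M × N → ℝ) (x : M) (y : N)
    (z : EuclideanSpace ℝ (Fin n) × EuclideanSpace ℝ (Fin n)) : ℝ :=
  c ((chartAt (EuclideanSpace ℝ (Fin n)) x).symm z.1,
    (chartAt (EuclideanSpace ℝ (Fin n)) y).symm z.2)

theorem mfderiv_eq_fderiv_comp_chart_symm {G : Type*} [NormedAddCommGroup G] [NormedSpace ℝ G]
    {f : M → G} {x : M} (hf : MDifferentiableAt (𝓡 n) 𝓘(ℝ, G) f x) :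
    mfderiv (𝓡 n) 𝓘(ℝ, G) f x = fderiv ℝ (f ∘ (chartAt (EuclideanSpace ℝ (Fin n)) x).symm)
      (chartAt (EuclideanSpace ℝ (Fin n)) x x) := by
  rw [hf.mfderiv]
  simp only [writtenInExtChartAt, mfld_simps, fderivWithin_univ]
  rfl

theorem contMDiffAt_of_comp_chart {G : Type*} [NormedAddCommGroup G] [NormedSpace ℝ G]
    [IsManifold (𝓡 n) ∞ M] {k : WithTop ℕ∞} (hk : k ≤ ∞) {f : M → G} {x : M}
    {F : EuclideanSpace ℝ (Fin n) → G}
    (hF : ContDiffAt ℝ k F (chartAt (EuclideanSpace ℝ (Fin n)) x x))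
    (hf : f =ᶠ[𝓝 x] F ∘ chartAt (EuclideanSpace ℝ (Fin n)) x) :
    ContMDiffAt (𝓡 n) 𝓘(ℝ, G) k f x := by
  have : IsManifold (𝓡 n) k M := IsManifold.of_le (n := ∞) hk
  refine ContMDiffAt.congr_of_eventuallyEq ?_ hf
  exact hF.contMDiffAt.comp x (contMDiffAt_of_mem_maximalAtlas
    (IsManifold.chart_mem_maximalAtlas x) (mem_chart_source _ x))

variable [IsManifold (𝓡 n) ∞ M] [IsManifold (𝓡 n) ∞ N] {c : M × N → ℝ}
  (hc : ContMDiff ((𝓡 n).prod (𝓡 n)) 𝓘(ℝ, ℝ) 2 c) (x : M) (y : N)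

include hc

theorem contDiffOn_costInCharts : ContDiffOn ℝ 2 (costInCharts c x y)
    ((chartAt (EuclideanSpace ℝ (Fin n)) x).target ×ˢ
      (chartAt (EuclideanSpace ℝ (Fin n)) y).target) := by
  have : IsManifold (𝓡 n) 2 M := IsManifold.of_le (n := ∞) (by norm_cast)
  have : IsManifold (𝓡 n) 2 N := IsManifold.of_le (n := ∞) (by norm_cast)
  have h := hc.comp_contMDiffOn ((contMDiffOn_chart_symm (I := 𝓡 n) (n := 2) (x := x)).prodMap
    (contMDiffOn_chart_symm (I := 𝓡 n) (n := 2) (x := y)))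
  rw [← contMDiffOn_iff_contDiffOn, modelWithCornersSelf_prod, ← chartedSpaceSelf_prod]
  exact h

theorem contDiffAt_costInCharts {z : EuclideanSpace ℝ (Fin n) × EuclideanSpace ℝ (Fin n)}
    (h1 : z.1 ∈ (chartAt (EuclideanSpace ℝ (Fin n)) x).target)
    (h2 : z.2 ∈ (chartAt (EuclideanSpace ℝ (Fin n)) y).target) :
    ContDiffAt ℝ 2 (costInCharts c x y) z :=
  (contDiffOn_costInCharts hc x y).contDiffAt
    (prod_mem_nhds ((chartAt _ x).open_target.mem_nhds h1) ((chartAt _ y).open_target.mem_nhds h2))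

theorem partialX_eq_fderivFst {y' : N} (hy' : y' ∈ (chartAt (EuclideanSpace ℝ (Fin n)) y).source) :
    partialX n c x y' = fderivFst (costInCharts c x y)
      (chartAt (EuclideanSpace ℝ (Fin n)) x x, chartAt (EuclideanSpace ℝ (Fin n)) y y') := by
  have hd : MDifferentiableAt (𝓡 n) 𝓘(ℝ, ℝ) (fun x' => c (x', y')) x :=
    ((hc (x, y')).comp x (contMDiffAt_id.prodMk contMDiffAt_const)).mdifferentiableAt two_ne_zero
  have h1 := hasFDerivAt_fderivFst ((contDiffAt_costInCharts hc x y
    (z := (chartAt _ x x, chartAt _ y y')) (mem_chart_target _ x)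
    ((chartAt _ y).map_source hy')).differentiableAt two_ne_zero)
  rw [partialX, mfderiv_eq_fderiv_comp_chart_symm hd, ← h1.fderiv]
  congr 1
  ext ξ
  simp [costInCharts, (chartAt (EuclideanSpace ℝ (Fin n)) y).left_inv hy']

theorem contDiffAt_fderivFst_costInCharts :
    ContDiffAt ℝ 1 (fderivFst (costInCharts c x y))
      (chartAt (EuclideanSpace ℝ (Fin n)) x x, chartAt (EuclideanSpace ℝ (Fin n)) y y) :=
  (contDiffAt_costInCharts hc x y (mem_chart_target _ x) (mem_chart_target _ y)).fderivFst

theorem contMDiff_partialX :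
    ContMDiff (𝓡 n) 𝓘(ℝ, EuclideanSpace ℝ (Fin n) →L[ℝ] ℝ) 1 (partialX n c x) := by
  intro y
  refine contMDiffAt_of_comp_chart (by norm_cast)
    (F := fun η => fderivFst (costInCharts c x y) (chartAt (EuclideanSpace ℝ (Fin n)) x x, η))
    ?_ ?_
  · exact (contDiffAt_fderivFst_costInCharts hc x y).comp _ (contDiffAt_const.prodMk contDiffAt_id)
  · filter_upwards [chart_source_mem_nhds (EuclideanSpace ℝ (Fin n)) y] with y' hy'
    exact partialX_eq_fderivFst hc x y hy'

theorem mixedHessian_apply (v : EuclideanSpace ℝ (Fin n)) :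
    mixedHessian n c x y v = fderiv ℝ (fderivFst (costInCharts c x y))
      (chartAt (EuclideanSpace ℝ (Fin n)) x x, chartAt (EuclideanSpace ℝ (Fin n)) y y)
      (0, v) := by
  have h1 : HasFDerivAt (fun η => fderivFst (costInCharts c x y)
      (chartAt (EuclideanSpace ℝ (Fin n)) x x, η)) _ (chartAt (EuclideanSpace ℝ (Fin n)) y y) :=
    ((contDiffAt_fderivFst_costInCharts hc x y).differentiableAt one_ne_zero).hasFDerivAt.comp _
      (hasFDerivAt_prodMk_right _ _)
  rw [mixedHessian, mfderiv_eq_fderiv_comp_chart_symm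
    ((contMDiff_partialX hc x y).mdifferentiableAt one_ne_zero)]
  have h2 : (partialX n c x) ∘ (chartAt (EuclideanSpace ℝ (Fin n)) y).symm
      =ᶠ[𝓝 (chartAt (EuclideanSpace ℝ (Fin n)) y y)] fun η =>
      fderivFst (costInCharts c x y) (chartAt (EuclideanSpace ℝ (Fin n)) x x, η) := by
    filter_upwards [(chartAt _ y).open_target.mem_nhds (mem_chart_target _ y)] with η hη
    rw [Function.comp_apply, partialX_eq_fderivFst hc x y ((chartAt _ y).map_target hη),
      (chartAt _ y).right_inv hη]
  rw [(h1.congr_of_eventuallyEq h2).fderiv]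
  rfl

/-- The map `y ↦ ∂c/∂x (x, y)` from the closed manifold `N` to `(T_x M)*` takes some value at two
points where it is a local diffeomorphism, as soon as there is one point where it is. -/
theorem exists_ne_partialX_eq [CompactSpace N] [T2Space N] (hn : 1 ≤ n)
    (hb : Function.Bijective (mixedHessian n c x y)) :
    ∃ y₁ y₂, y₁ ≠ y₂ ∧ partialX n c x y₁ = partialX n c x y₂ ∧
      Function.Bijective (mixedHessian n c x y₁) ∧ Function.Bijective (mixedHessian n c x y₂) := by
  let B := (LinearEquiv.ofBijective (mixedHessian n c x y :
    EuclideanSpace ℝ (Fin n) →ₗ[ℝ] (EuclideanSpace ℝ (Fin n) →L[ℝ] ℝ)) hb).toContinuousLinearEquiv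
  have hsm : ContMDiff (𝓡 n) (𝓡 n) 1 (B.symm ∘ partialX n c x) :=
    B.symm.contDiff.contMDiff.comp (contMDiff_partialX hc x)
  have hder : ∀ y' v, mfderiv (𝓡 n) (𝓡 n) (B.symm ∘ partialX n c x) y' v =
      B.symm (mixedHessian n c x y' v) := by
    intro y' v
    have h1 : HasMFDerivAt (𝓡 n) 𝓘(ℝ, EuclideanSpace ℝ (Fin n) →L[ℝ] ℝ) (partialX n c x) y'
        (mixedHessian n c x y') :=
      ((contMDiff_partialX hc x y').mdifferentiableAt one_ne_zero).hasMFDerivAt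
    have h2 := HasMFDerivAt.comp y'
      (B.symm : (EuclideanSpace ℝ (Fin n) →L[ℝ] ℝ) →L[ℝ] EuclideanSpace ℝ (Fin n)).hasMFDerivAt h1
    have h3 := h2.mfderiv
    exact congrArg (fun l => l v) h3
  have hiff : ∀ y', Function.Bijective (mfderiv (𝓡 n) (𝓡 n) (B.symm ∘ partialX n c x) y') ↔
      Function.Bijective (mixedHessian n c x y') := by
    intro y'
    rw [show (mfderiv (𝓡 n) (𝓡 n) (B.symm ∘ partialX n c x) y' : _ → _) =
      B.symm ∘ mixedHessian n c x y' from funext (hder y')]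
    exact Function.Bijective.of_comp_iff' B.symm.bijective _
  obtain ⟨y₁, y₂, hne, heq, h1, h2⟩ := exists_ne_map_eq_of_bijective_mfderiv hn hsm ((hiff y).2 hb)
  exact ⟨y₁, y₂, hne, B.symm.injective heq, (hiff _).1 h1, (hiff _).1 h2⟩

end Coordinates

/-! ### Optimal plans which are not concentrated on a graph -/

section NonGraph

open unitInterval

variable {n : ℕ} {M N : Type*}
  [TopologicalSpace M] [T2Space M] [CompactSpace M]
  [ChartedSpace (EuclideanSpace ℝ (Fin n)) M] [IsManifold (𝓡 n) ∞ M]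
  [MeasurableSpace M] [BorelSpace M]
  [TopologicalSpace N] [T2Space N] [CompactSpace N]
  [ChartedSpace (EuclideanSpace ℝ (Fin n)) N] [IsManifold (𝓡 n) ∞ N]
  [MeasurableSpace N] [BorelSpace N]

/-- Let `y₁ ≠ y₂` be two points where `y ↦ ∂c/∂x (x₀, y)` is a local diffeomorphism and takes the same
value `p`. The very concave potential `p ξ - K ‖ξ - ξ₀‖ ^ 2` then matches the points of a small cube
at `x₀` both to points near `y₁` and to points near `y₂`, and each of them receives half of the
mass. -/
theorem exists_nonGraph_optimalPlan (hn : 1 ≤ n) {c : M × N → ℝ}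
    (hc : ContMDiff ((𝓡 n).prod (𝓡 n)) 𝓘(ℝ, ℝ) 2 c) (hinv : HasInvertibleMixedHessian n c) :
    ∃ (μ : Measure M) (ν : Measure N),
      IsProbabilityMeasure μ ∧ IsProbabilityMeasure ν ∧
      IsLebesgueAC n μ ∧ IsLebesgueAC n ν ∧
      (∃ γ : Measure (M × N), IsOptimalPlan c μ ν γ ∧
        (∀ γ' : Measure (M × N), IsOptimalPlan c μ ν γ' → γ' = γ) ∧
        ¬ IsSupportedOnGraph γ) ∧
      ¬ ∃ T : M → N, IsMongeSolution c μ ν T := by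
  obtain ⟨x₀, y₀, hb⟩ := hinv
  obtain ⟨m, rfl⟩ : ∃ m, n = m + 1 := ⟨n - 1, by omega⟩
  have : SecondCountableTopology M :=
    ChartedSpace.secondCountable_of_sigmaCompact (EuclideanSpace ℝ (Fin (m + 1))) M
  have : SecondCountableTopology N :=
    ChartedSpace.secondCountable_of_sigmaCompact (EuclideanSpace ℝ (Fin (m + 1))) N
  obtain ⟨y₁, y₂, hne, hpart, hb₁, hb₂⟩ := exists_ne_partialX_eq hc x₀ y₀ hn hb
  let y : Bool → N := fun b => cond b y₁ y₂
  set e := chartAt (EuclideanSpace ℝ (Fin (m + 1))) x₀ with he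
  set ξ₀ := e x₀
  have hξ₀ : ξ₀ ∈ e.target := mem_chart_target _ x₀
  let e' : Bool → OpenPartialHomeomorph N (EuclideanSpace ℝ (Fin (m + 1))) :=
    fun b => chartAt (EuclideanSpace ℝ (Fin (m + 1))) (y b)
  let C : Bool → EuclideanSpace ℝ (Fin (m + 1)) × EuclideanSpace ℝ (Fin (m + 1)) → ℝ :=
    fun b => costInCharts c x₀ (y b)
  let η₀ : Bool → EuclideanSpace ℝ (Fin (m + 1)) := fun b => e' b (y b)
  have hη₀ : ∀ b, η₀ b ∈ (e' b).target := fun b => mem_chart_target _ (y b)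
  set p := partialX (m + 1) c x₀ y₂ with hp
  have hpb : ∀ b, fderivFst (C b) (ξ₀, η₀ b) = p := by
    intro b
    have h1 := (partialX_eq_fderivFst hc x₀ (y b) (mem_chart_source _ (y b))).symm
    cases b
    · exact h1
    · exact h1.trans hpart
  have hloc := fun b => exists_localPotential (C := C b) (ξ₀ := ξ₀) (η₀ := η₀ b)
    (contDiffAt_costInCharts hc x₀ (y b) hξ₀ (hη₀ b)) (by
      have h1 : Function.Bijective (mixedHessian (m + 1) c x₀ (y b)) := by cases b <;> assumption
      have h2 : (mixedHessian (m + 1) c x₀ (y b) : _ → _) =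
          fun v => fderiv ℝ (fderivFst (C b)) (ξ₀, η₀ b) (0, v) :=
        funext (mixedHessian_apply hc x₀ (y b))
      rw [h2] at h1
      exact h1)
  choose A hA ρ₀ hρ₀ hloc using hloc
  set K := max (A true) (A false) with hK
  have hKA : ∀ b, A b ≤ K := fun b => by
    cases b
    · exact le_max_right _ _
    · exact le_max_left _ _
  -- The two points `y₁` and `y₂` are separated, so that their neighborhoods never mix.
  obtain ⟨O₁, O₂, hO₁, hO₂, hy₁, hy₂, hdisj⟩ := t2_separation hne
  let O : Bool → Set N := fun b => cond b O₁ O₂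
  have hO : ∀ b, IsOpen (O b) := fun b => by cases b <;> assumption
  have hyO : ∀ b, y b ∈ O b := fun b => by cases b <;> assumption
  have hOd : ∀ z b b', z ∈ O b → z ∈ O b' → b = b' := by
    intro z b b' h h'
    cases b <;> cases b'
    · rfl
    · exact (Set.disjoint_left.1 hdisj h' h).elim
    · exact (Set.disjoint_left.1 hdisj h h').elim
    · rfl
  have hU : ∀ b, (e' b).target ∩ (e' b).symm ⁻¹' (O b) ∈ 𝓝 (η₀ b) := fun b =>
    Filter.inter_mem ((e' b).open_target.mem_nhds (hη₀ b))
      (((e' b).continuousAt_symm (hη₀ b)).preimage_mem_nhds ((hO b).mem_nhds (by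
        rw [(e' b).left_inv (mem_chart_source _ (y b))]; exact hyO b)))
  choose r hr Y hYc hYU hYmin hYlip using fun b => hloc b K (hKA b) _ (hU b)
  obtain ⟨ρ₁, hρ₁, hρ₁e⟩ := Metric.isOpen_iff.1 e.open_target ξ₀ hξ₀
  set ρ := min ρ₁ (min (ρ₀ true) (ρ₀ false)) with hρ
  have hρ0 : 0 < ρ := lt_min hρ₁ (lt_min (hρ₀ _) (hρ₀ _))
  have hρe : Metric.ball ξ₀ ρ ⊆ e.target :=
    (Metric.ball_subset_ball (min_le_left _ _)).trans hρ₁e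
  have hρρ : ∀ b, Metric.ball ξ₀ ρ ⊆ Metric.ball ξ₀ (ρ₀ b) := fun b =>
    Metric.ball_subset_ball ((min_le_right _ _).trans (by
      cases b
      · exact min_le_right _ _
      · exact min_le_left _ _))
  set ε := min ρ (min (r true) (r false)) with hε
  have hε0 : 0 < ε := lt_min hρ0 (lt_min (hr _) (hr _))
  have hερ : Metric.ball ξ₀ ε ⊆ Metric.ball ξ₀ ρ := Metric.ball_subset_ball (min_le_left _ _)
  have hεr : ∀ b, Metric.ball ξ₀ ε ⊆ Metric.ball ξ₀ (r b) := fun b =>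
    Metric.ball_subset_ball ((min_le_right _ _).trans (by
      cases b
      · exact min_le_right _ _
      · exact min_le_left _ _))
  obtain ⟨s, hs, hcube⟩ := exists_cubeMap_mem_ball ξ₀ hε0
  set κ := cubeMap ξ₀ s with hκ
  have hκc : Continuous κ := continuous_cubeMap ξ₀ s
  have hκi : Function.Injective κ := injective_cubeMap ξ₀ hs.ne'
  set w : EuclideanSpace ℝ (Fin (m + 1)) → ℝ := fun ξ => p ξ - K * ‖ξ - ξ₀‖ ^ 2 with hw
  have hwc : Continuous w := by fun_prop
  obtain ⟨W, hW⟩ := ((isCompact_closedBall ξ₀ ρ).image hwc).isBounded.exists_norm_le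
  have hWb : ∀ ξ ∈ Metric.ball ξ₀ ρ, |w ξ| ≤ W := fun ξ hξ =>
    hW _ ⟨ξ, Metric.ball_subset_closedBall hξ, rfl⟩
  have hW0 : 0 ≤ W := (abs_nonneg _).trans (hWb ξ₀ (Metric.mem_ball_self hρ0))
  obtain ⟨B, hB⟩ := (isCompact_range hc.continuous).isBounded.exists_norm_le
  have hcB : ∀ p, |c p| ≤ B := fun p => hB _ ⟨p, rfl⟩
  have hB0 : 0 ≤ B := (abs_nonneg _).trans (hcB (x₀, y₀))
  -- The potential is `w` near `x₀`, and so low elsewhere that no point there can compete.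
  set D : Set M := e.source ∩ e ⁻¹' Metric.ball ξ₀ ρ with hD
  have hDo : IsOpen D := e.isOpen_inter_preimage Metric.isOpen_ball
  classical
  set u : M → ℝ := D.piecewise (w ∘ e) (fun _ => -(W + 2 * B + 1)) with hu
  have hum : Measurable u := ContinuousOn.measurable_piecewise
    (hwc.comp_continuousOn (e.continuousOn.mono Set.inter_subset_left)) continuousOn_const
    hDo.measurableSet
  have huD : ∀ x ∈ D, u x = w (e x) := fun x hx => Set.piecewise_eq_of_mem _ _ _ hx
  have huD' : ∀ x ∉ D, u x = -(W + 2 * B + 1) := fun x hx => Set.piecewise_eq_of_notMem _ _ _ hx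
  have hub : ∀ x, |u x| ≤ W + 2 * B + 1 := by
    intro x
    by_cases hx : x ∈ D
    · rw [huD x hx]
      linarith [hWb _ hx.2]
    · rw [huD' x hx, abs_neg, abs_of_nonneg (by positivity)]
  have hκt : ∀ x, κ x ∈ e.target := fun x => hρe (hερ (hcube x))
  have hYt : ∀ b x, Y b (κ x) ∈ (e' b).target ∧ (e' b).symm (Y b (κ x)) ∈ O b := fun b x =>
    hYU b (hεr b (hcube x))
  set ψ : I × (Fin m → I) → M := fun x => e.symm (κ x) with hψ
  have hψc : Continuous ψ := e.continuousOn_symm.comp_continuous hκc hκt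
  have hψi : Function.Injective ψ := fun x x' h =>
    hκi (e.symm.injOn (hκt x) (hκt x') h)
  have heψ : ∀ x, e (ψ x) = κ x := fun x => e.right_inv (hκt x)
  have hψD : ∀ x, ψ x ∈ D := fun x => ⟨e.map_target (hκt x), by
    rw [Set.mem_preimage, heψ]; exact hερ (hcube x)⟩
  set a : (I × (Fin m → I)) × Bool → N := fun q => (e' q.2).symm (Y q.2 (κ q.1)) with ha
  have hac : Continuous a := by
    have h1 : ∀ b, Continuous fun x => a (x, b) := fun b =>
      (e' b).continuousOn_symm.comp_continuous
        ((hYc b).comp_continuous hκc fun x => hεr b (hcube x)) fun x => (hYt b x).1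
    exact continuous_prod_of_discrete_right.2 h1
  -- Inside `D` this is the strict minimum property of the local potential; outside, it holds by the
  -- choice of the constant value of `u`.
  have hmin : ∀ (q : (I × (Fin m → I)) × Bool) (x : M), x ≠ ψ q.1 →
      c (ψ q.1, a q) - u (ψ q.1) < c (x, a q) - u x := by
    rintro ⟨z, b⟩ x hx
    rw [huD _ (hψD z), heψ]
    by_cases hxD : x ∈ D
    · have h1 := hYmin b (κ z) (hεr b (hcube z)) (e x) (hρρ b hxD.2)
      rw [hpb b] at h1
      have h2 : C b (e x, Y b (κ z)) = c (x, a (z, b)) := by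
        simp only [C, costInCharts, ← he, e.left_inv hxD.1]
        rfl
      rw [h2] at h1
      have h3 : 0 < ‖e x - κ z‖ := by
        rw [norm_pos_iff, sub_ne_zero]
        intro h
        exact hx (by rw [← e.left_inv hxD.1, h])
      rw [huD x hxD]
      have h4 : C b (κ z, Y b (κ z)) = c (ψ z, a (z, b)) := rfl
      rw [h4] at h1
      simp only [hw]
      nlinarith
    · rw [huD' x hxD]
      have h1 := abs_le.1 (hcB (ψ z, a (z, b)))
      have h2 := abs_le.1 (hcB (x, a (z, b)))
      have h3 := abs_le.1 (hWb _ (hερ (hcube z)))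
      simp only at h1 h2 ⊢
      linarith
  -- A point `y` determines the unique minimizer of `c (·, y) - u`.
  have hai : Function.Injective a := by
    rintro ⟨z, b⟩ ⟨z', b'⟩ h
    have hbb : b = b' := hOd _ b b' (hYt b z).2 (by
      have := (hYt b' z').2
      rwa [show (e' b').symm (Y b' (κ z')) = (e' b).symm (Y b (κ z)) from h.symm] at this)
    subst hbb
    have hzz : z = z' := by
      by_contra hzz
      have h1 := hmin (z, b) (ψ z') fun h' => hzz (hψi h').symm
      have h2 := hmin (z', b) (ψ z) fun h' => hzz (hψi h')
      rw [← h] at h2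
      simp only at h1 h2
      linarith
    rw [hzz]
  have hψe : MeasurableEmbedding ψ := (hψc.isClosedEmbedding hψi).measurableEmbedding
  have hae : MeasurableEmbedding a := (hac.isClosedEmbedding hai).measurableEmbedding
  refine ⟨(volume : Measure (I × (Fin m → I))).map ψ,
    ((volume : Measure (I × (Fin m → I))).prod fairCoin).map a,
    Measure.isProbabilityMeasure_map hψe.measurable.aemeasurable,
    Measure.isProbabilityMeasure_map hae.measurable.aemeasurable, ?_, ?_,
    exists_unique_optimalPlan_of_potential volume
      (hasFineSplitting_unitInterval.prod (volume : Measure (Fin m → I))) hc.continuous hψc hψi hac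
      hai hum hub hmin⟩
  · intro T hT
    rw [hψe.map_apply]
    refine measure_mono_null (fun z hz => ?_)
      (volume_cubeMap_preimage_eq_zero ξ₀ hs.ne' (hT e (IsManifold.chart_mem_maximalAtlas x₀)))
    exact ⟨ψ z, ⟨(hψD z).1, hz⟩, heψ z⟩
  · -- The maps `Y b` have Lipschitz inverses, so preimages of null sets are null.
    intro T hT
    rw [hae.map_apply]
    have hnull : ∀ b, volume {z : I × (Fin m → I) | a (z, b) ∈ T} = 0 := by
      intro b
      have h0 := hT (e' b) (IsManifold.chart_mem_maximalAtlas (y b))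
      refine measure_mono_null (fun z hz => ?_) (volume_cubeMap_preimage_eq_zero ξ₀ hs.ne'
        (volume_eq_zero_of_antilipschitzOn (Y := Y b) (A := A b)
          (s := Metric.ball ξ₀ (r b) ∩ Y b ⁻¹' (e' b '' ((e' b).source ∩ T)))
          (fun ξ hξ ξ' hξ' => hYlip b ξ hξ.1 ξ' hξ'.1)
          (measure_mono_null (by rintro _ ⟨ξ, hξ, rfl⟩; exact hξ.2) h0)))
      exact ⟨hεr b (hcube z), a (z, b), ⟨(e' b).map_target (hYt b z).1, hz⟩,
        (e' b).right_inv (hYt b z).1⟩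
    refine measure_mono_null (t := ⋃ b, {z | a (z, b) ∈ T} ×ˢ Set.univ) (fun q hq => ?_) ?_
    · exact Set.mem_iUnion.2 ⟨q.2, hq, Set.mem_univ _⟩
    · refine measure_iUnion_null fun b => ?_
      rw [Measure.prod_prod, hnull b, zero_mul]

end NonGraph

/-! ### The topology of uniform convergence of derivatives -/

section CkTopology

variable {E H X : Type*} [NormedAddCommGroup E] [NormedSpace ℝ E] [TopologicalSpace H]
  {I : ModelWithCorners ℝ E H} [TopologicalSpace X] [ChartedSpace H X] {k : ℕ}

theorem continuous_iteratedFDeriv_ckTopology {e : OpenPartialHomeomorph X H}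
    (he : e ∈ IsManifold.maximalAtlas I ∞ X) {j : ℕ} (hj : j ≤ k) {u : E}
    (hu : u ∈ (e.extend I).target) :
    Continuous[ckTopology I X k, inferInstance] fun f : ContMDiffMap I 𝓘(ℝ, ℝ) X ℝ k =>
      iteratedFDeriv ℝ j (fun u => f ((e.extend I).symm u)) u := by
  let _ : TopologicalSpace _ := ckTopology I X k
  have h1 : Continuous fun f : ContMDiffMap I 𝓘(ℝ, ℝ) X ℝ k =>
      UniformOnFun.ofFun {K : Set E | IsCompact K ∧ K ⊆ (e.extend I).target}
        (iteratedFDeriv ℝ j (fun u => f ((e.extend I).symm u))) := by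
    rw [continuous_iff_le_induced]
    exact (iInf₂_le e he).trans (iInf₂_le j hj)
  exact (UniformOnFun.uniformContinuous_eval_of_mem _ _ (Set.mem_singleton u)
    (show {u} ∈ {K : Set E | IsCompact K ∧ K ⊆ (e.extend I).target} from
      ⟨isCompact_singleton, Set.singleton_subset_iff.2 hu⟩)).continuous.comp h1

variable [I.Boundaryless] [IsManifold I ∞ X]

theorem contDiffAt_comp_extend_symm {f : X → ℝ} (hf : ContMDiff I 𝓘(ℝ, ℝ) k f)
    {e : OpenPartialHomeomorph X H} (he : e ∈ IsManifold.maximalAtlas I ∞ X) {u : E}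
    (hu : u ∈ (e.extend I).target) : ContDiffAt ℝ k (fun u => f ((e.extend I).symm u)) u := by
  have : IsManifold I k X := IsManifold.of_le (n := ∞) (by exact_mod_cast le_top)
  have he' : e ∈ IsManifold.maximalAtlas I k X :=
    IsManifold.maximalAtlas_subset_of_le (n := ∞) (by exact_mod_cast le_top) he
  have h1 := hf.comp_contMDiffOn (contMDiffOn_extend_symm he')
  rw [contMDiffOn_iff_contDiffOn] at h1
  have htarget : (e.extend I).target = I '' e.target := by
    simp [I.image_eq, Set.inter_comm]
  rw [← htarget] at h1
  exact h1.contDiffAt ((e.isOpen_extend_target).mem_nhds hu)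

theorem iteratedFDeriv_add_smul_comp_extend_symm (f g : ContMDiffMap I 𝓘(ℝ, ℝ) X ℝ k) (t : ℝ)
    {e : OpenPartialHomeomorph X H} (he : e ∈ IsManifold.maximalAtlas I ∞ X) {j : ℕ} (hj : j ≤ k)
    {u : E} (hu : u ∈ (e.extend I).target) :
    iteratedFDeriv ℝ j (fun u => (f + t • g) ((e.extend I).symm u)) u =
      iteratedFDeriv ℝ j (fun u => f ((e.extend I).symm u)) u +
        t • iteratedFDeriv ℝ j (fun u => g ((e.extend I).symm u)) u := by
  have hf := (contDiffAt_comp_extend_symm f.contMDiff he hu).of_le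
    (show (j : WithTop ℕ∞) ≤ k by exact_mod_cast hj)
  have hg := (contDiffAt_comp_extend_symm g.contMDiff he hu).of_le
    (show (j : WithTop ℕ∞) ≤ k by exact_mod_cast hj)
  have h1 := iteratedFDeriv_add_apply hf (hg.const_smul t)
  have h2 := iteratedFDeriv_const_smul_apply (a := t) hg
  exact h1.trans (congrArg _ h2)

theorem tendsto_add_smul_ckTopology (f g : ContMDiffMap I 𝓘(ℝ, ℝ) X ℝ k) :
    Filter.Tendsto (fun t : ℝ => f + t • g) (𝓝 0) (@nhds _ (ckTopology I X k) f) := by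
  rw [ckTopology]
  simp only [nhds_iInf, Filter.tendsto_iInf, nhds_induced, Filter.tendsto_comap_iff]
  intro e he j hj
  rw [UniformOnFun.tendsto_iff_tendstoUniformlyOn]
  rintro K ⟨hK, hKt⟩
  have hcont : ContinuousOn (iteratedFDeriv ℝ j (fun u => g ((e.extend I).symm u))) K := by
    intro u hu
    exact ((contDiffAt_comp_extend_symm g.contMDiff he (hKt hu)).continuousAt_iteratedFDeriv
      (by exact_mod_cast hj)).continuousWithinAt
  obtain ⟨B, hB⟩ := (hK.image_of_continuousOn hcont).isBounded.exists_norm_le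
  rw [Metric.tendstoUniformlyOn_iff]
  intro ε hε
  have hlim : Filter.Tendsto (fun t : ℝ => |t| * |B|) (𝓝 0) (𝓝 0) := by
    have : Continuous fun t : ℝ => |t| * |B| := by fun_prop
    simpa using this.tendsto 0
  filter_upwards [hlim.eventually_lt_const hε] with t ht u hu
  simp only [Function.comp_apply, UniformOnFun.toFun_ofFun]
  rw [iteratedFDeriv_add_smul_comp_extend_symm f g t he hj (hKt hu), dist_self_add_right, norm_smul,
    Real.norm_eq_abs]
  refine lt_of_le_of_lt (mul_le_mul_of_nonneg_left ?_ (abs_nonneg t)) ht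
  exact (hB _ ⟨u, hu, rfl⟩).trans (le_abs_self B)

end CkTopology

/-! ### Openness and density of invertible mixed Hessians -/

section MixedHessianOpenDense

theorem eventually_smul_chart_symm {n : ℕ} {M : Type*} [TopologicalSpace M]
    (e : OpenPartialHomeomorph M (EuclideanSpace ℝ (Fin n)))
    {x : M} (hx : x ∈ e.source) {χ : M → ℝ} (hχ : χ =ᶠ[𝓝 x] 1) :
    ∀ᶠ u in 𝓝 (e x), χ (e.symm u) • e (e.symm u) = u := by
  have ht := e.continuousAt_symm (e.map_source hx)
  rw [ContinuousAt, e.left_inv hx] at ht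
  filter_upwards [ht.eventually hχ, e.open_target.mem_nhds (e.map_source hx)] with u h1 h2
  rw [h1, e.right_inv h2, Pi.one_apply, one_smul]

variable {n : ℕ} {M N : Type*} [TopologicalSpace M] [ChartedSpace (EuclideanSpace ℝ (Fin n)) M]
  [TopologicalSpace N] [ChartedSpace (EuclideanSpace ℝ (Fin n)) N]
  [IsManifold (𝓡 n) ∞ M] [IsManifold (𝓡 n) ∞ N]

theorem mixedHessian_apply_apply {c : M × N → ℝ}
    (hc : ContMDiff ((𝓡 n).prod (𝓡 n)) 𝓘(ℝ, ℝ) 2 c) (x : M) (y : N)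
    (v w : EuclideanSpace ℝ (Fin n)) :
    mixedHessian n c x y v w = iteratedFDeriv ℝ 2
      (fun u => c (((chartAt (ModelProd (EuclideanSpace ℝ (Fin n)) (EuclideanSpace ℝ (Fin n)))
        (x, y)).extend ((𝓡 n).prod (𝓡 n))).symm u))
      (chartAt (EuclideanSpace ℝ (Fin n)) x x, chartAt (EuclideanSpace ℝ (Fin n)) y y)
      ![(0, v), (w, 0)] := by
  rw [mixedHessian_apply hc, iteratedFDeriv_two_apply]
  have hd := ((contDiffAt_costInCharts hc x y (z := (chartAt _ x x, chartAt _ y y))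
    (mem_chart_target _ x) (mem_chart_target _ y)).fderiv_right (m := 1)
    (by norm_num)).differentiableAt one_ne_zero
  have h1 : HasFDerivAt (fderivFst (costInCharts c x y)) _ _ :=
    hd.hasFDerivAt.clm_comp (hasFDerivAt_const (ContinuousLinearMap.inl ℝ _ _) _)
  rw [h1.fderiv]
  simp
  rfl

omit [IsManifold (𝓡 n) ∞ M] [IsManifold (𝓡 n) ∞ N] in
theorem mem_extend_chartAt_target (x : M) (y : N) :
    (chartAt (EuclideanSpace ℝ (Fin n)) x x, chartAt (EuclideanSpace ℝ (Fin n)) y y) ∈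
      ((chartAt (ModelProd (EuclideanSpace ℝ (Fin n)) (EuclideanSpace ℝ (Fin n)))
        (x, y)).extend ((𝓡 n).prod (𝓡 n))).target :=
  mem_extChartAt_target (I := (𝓡 n).prod (𝓡 n)) (x, y)

theorem continuous_mixedHessian (x : M) (y : N) :
    Continuous[ckTopology ((𝓡 n).prod (𝓡 n)) (M × N) 2, inferInstance]
      fun c : ContMDiffMap ((𝓡 n).prod (𝓡 n)) 𝓘(ℝ, ℝ) (M × N) ℝ ((2 : ℕ) : WithTop ℕ∞) =>
        mixedHessian n (c : M × N → ℝ) x y := by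
  let _ : TopologicalSpace _ := ckTopology ((𝓡 n).prod (𝓡 n)) (M × N) 2
  refine continuous_clm_apply.2 fun v => continuous_clm_apply.2 fun w => ?_
  have h := continuous_iteratedFDeriv_ckTopology (k := 2) (I := (𝓡 n).prod (𝓡 n))
    (IsManifold.chart_mem_maximalAtlas (x, y)) le_rfl (mem_extend_chartAt_target x y)
  have h2 := (continuous_eval_const (F := ContinuousMultilinearMap ℝ
    (fun _ : Fin 2 => EuclideanSpace ℝ (Fin n) × EuclideanSpace ℝ (Fin n)) ℝ)
    ![(0, v), (w, 0)]).comp h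
  refine h2.congr fun c => ?_
  exact (mixedHessian_apply_apply c.contMDiff x y v w).symm

theorem isOpen_setOf_bijective {E F : Type*} [NormedAddCommGroup E] [NormedSpace ℝ E]
    [FiniteDimensional ℝ E] [NormedAddCommGroup F] [NormedSpace ℝ F] [FiniteDimensional ℝ F] :
    IsOpen {L : E →L[ℝ] F | Function.Bijective L} := by
  convert ContinuousLinearEquiv.isOpen (𝕜 := ℝ) (E := E) (F := F)
  ext L
  constructor
  · intro h
    exact ⟨(LinearEquiv.ofBijective (L : E →ₗ[ℝ] F) h).toContinuousLinearEquiv, by ext; rfl⟩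
  · rintro ⟨e, rfl⟩
    exact e.bijective

theorem isOpen_hasInvertibleMixedHessian :
    IsOpen[ckTopology ((𝓡 n).prod (𝓡 n)) (M × N) 2]
      {c | HasInvertibleMixedHessian n (c : M × N → ℝ)} := by
  let _ : TopologicalSpace _ := ckTopology ((𝓡 n).prod (𝓡 n)) (M × N) 2
  have : {c : ContMDiffMap ((𝓡 n).prod (𝓡 n)) 𝓘(ℝ, ℝ) (M × N) ℝ ((2 : ℕ) : WithTop ℕ∞) |
      HasInvertibleMixedHessian n (c : M × N → ℝ)} =
      ⋃ (x : M) (y : N), (fun c : ContMDiffMap ((𝓡 n).prod (𝓡 n)) 𝓘(ℝ, ℝ) (M × N) ℝ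
        ((2 : ℕ) : WithTop ℕ∞) => mixedHessian n (c : M × N → ℝ) x y) ⁻¹'
          {L | Function.Bijective L} := by
    ext c
    simp [HasInvertibleMixedHessian]
  rw [this]
  exact isOpen_iUnion fun x => isOpen_iUnion fun y =>
    isOpen_setOf_bijective.preimage (continuous_mixedHessian x y)

theorem mixedHessian_add_smul
    (c φ : ContMDiffMap ((𝓡 n).prod (𝓡 n)) 𝓘(ℝ, ℝ) (M × N) ℝ ((2 : ℕ) : WithTop ℕ∞)) (t : ℝ)
    (x : M) (y : N) : mixedHessian n ((c + t • φ : ContMDiffMap ((𝓡 n).prod (𝓡 n)) 𝓘(ℝ, ℝ) (M × N) ℝ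
      ((2 : ℕ) : WithTop ℕ∞)) : M × N → ℝ) x y =
      mixedHessian n (c : M × N → ℝ) x y + t • mixedHessian n (φ : M × N → ℝ) x y := by
  ext v w
  have h := iteratedFDeriv_add_smul_comp_extend_symm (k := 2) (I := (𝓡 n).prod (𝓡 n)) c φ t
    (IsManifold.chart_mem_maximalAtlas (x, y)) le_rfl (mem_extend_chartAt_target x y)
  have h' := congrArg (fun l => l ![(0, v), (w, 0)]) h
  simp only [add_apply, smul_apply]
  rw [mixedHessian_apply_apply c.contMDiff, mixedHessian_apply_apply φ.contMDiff,
    mixedHessian_apply_apply (c + t • φ).contMDiff]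
  exact h'

/-- A smooth cost which, in the charts at `x` and `y`, is the inner product near `(x, y)`. -/
theorem exists_mixedHessian_eq_innerSL [T2Space M] [T2Space N] (x : M) (y : N) :
    ∃ φ : ContMDiffMap ((𝓡 n).prod (𝓡 n)) 𝓘(ℝ, ℝ) (M × N) ℝ ((2 : ℕ) : WithTop ℕ∞),
      ∀ v, mixedHessian n (φ : M × N → ℝ) x y v = innerSL ℝ v := by
  let χ : SmoothBumpFunction (𝓡 n) x := Classical.arbitrary _
  let χ' : SmoothBumpFunction (𝓡 n) y := Classical.arbitrary _
  have hα : ContMDiff (𝓡 n) (𝓡 n) ∞ fun x' => χ x' • chartAt (EuclideanSpace ℝ (Fin n)) x x' :=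
    χ.contMDiff_smul contMDiffOn_chart
  have hβ : ContMDiff (𝓡 n) (𝓡 n) ∞ fun y' => χ' y' • chartAt (EuclideanSpace ℝ (Fin n)) y y' :=
    χ'.contMDiff_smul contMDiffOn_chart
  let f : M × N → ℝ := fun q => inner ℝ (χ q.1 • chartAt (EuclideanSpace ℝ (Fin n)) x q.1)
    (χ' q.2 • chartAt (EuclideanSpace ℝ (Fin n)) y q.2)
  have hf : ContMDiff ((𝓡 n).prod (𝓡 n)) 𝓘(ℝ, ℝ) ((2 : ℕ) : WithTop ℕ∞) f := by
    have h1 := (contDiff_inner (𝕜 := ℝ) (E := EuclideanSpace ℝ (Fin n)) (n := ∞)).contMDiff.comp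
      ((hα.comp contMDiff_fst).prodMk_space (hβ.comp contMDiff_snd))
    exact h1.of_le (by norm_cast)
  refine ⟨⟨f, hf⟩, fun v => ?_⟩
  change mixedHessian n f x y v = innerSL ℝ v
  rw [mixedHessian_apply hf]
  set z₀ := (chartAt (EuclideanSpace ℝ (Fin n)) x x, chartAt (EuclideanSpace ℝ (Fin n)) y y)
  have h1 : costInCharts f x y =ᶠ[𝓝 z₀] fun z => inner ℝ z.1 z.2 := by
    have e1 := eventually_smul_chart_symm (chartAt (EuclideanSpace ℝ (Fin n)) x)
      (mem_chart_source _ x) χ.eventuallyEq_one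
    have e2 := eventually_smul_chart_symm (chartAt (EuclideanSpace ℝ (Fin n)) y)
      (mem_chart_source _ y) χ'.eventuallyEq_one
    filter_upwards [e1.prod_nhds e2] with z hz
    simp only [costInCharts, f]
    rw [hz.1, hz.2]
  have h2 : fderivFst (costInCharts f x y) =ᶠ[𝓝 z₀]
      (innerSL ℝ).comp (ContinuousLinearMap.snd ℝ _ _) := by
    filter_upwards [h1.eventuallyEq_nhds] with z hz
    ext w
    have h3 := (hasFDerivAt_id z).fst.inner ℝ (hasFDerivAt_id z).snd
    rw [fderivFst, hz.fderiv_eq]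
    simp only [id] at h3
    rw [h3.fderiv]
    simp [real_inner_comm]
  rw [h2.fderiv_eq, ContinuousLinearMap.fderiv]
  rfl

/-- Composed with `Q⁻¹`, the map `P + t • Q` has as determinant the value at `t` of the characteristic
polynomial of `-Q⁻¹ P`, which has finitely many roots. -/
theorem frequently_bijective_add_smul {E F : Type*} [NormedAddCommGroup E] [NormedSpace ℝ E]
    [FiniteDimensional ℝ E] [NormedAddCommGroup F] [NormedSpace ℝ F] [FiniteDimensional ℝ F]
    (P Q : E →L[ℝ] F) (hQ : Function.Bijective Q) :
    ∃ᶠ t in 𝓝 (0 : ℝ), Function.Bijective (P + t • Q : E →L[ℝ] F) := by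
  let Q' := (LinearEquiv.ofBijective (Q : E →ₗ[ℝ] F) hQ).toContinuousLinearEquiv
  set A : E →ₗ[ℝ] E := -(((Q'.symm : F →L[ℝ] E).comp P : E →L[ℝ] E) : E →ₗ[ℝ] E) with hA
  have hroots : {t : ℝ | A.charpoly.IsRoot t}.Finite :=
    Polynomial.finite_setOfPred_isRoot A.charpoly_monic.ne_zero
  have hne : ∀ t, ¬ A.charpoly.IsRoot t → Function.Bijective (P + t • Q : E →L[ℝ] F) := by
    intro t ht
    have h1 : (t • ContinuousLinearMap.id ℝ E + (Q'.symm : F →L[ℝ] E).comp P).det ≠ 0 := by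
      rw [Polynomial.IsRoot, LinearMap.eval_charpoly] at ht
      convert ht using 1
      rw [ContinuousLinearMap.det]
      congr 1
      ext v
      simp [hA, Module.algebraMap_end_apply]
    rw [ContinuousLinearMap.det_ne_zero_iff_bijective] at h1
    have h2 : (P + t • Q : E →L[ℝ] F) =
        (Q' : E →L[ℝ] F).comp (t • ContinuousLinearMap.id ℝ E + (Q'.symm : F →L[ℝ] E).comp P) := by
      ext v
      have : Q' v = Q v := rfl
      simp [this, add_comm]
    rw [h2]
    exact Q'.bijective.comp h1
  have hev : ∀ᶠ t in 𝓝[≠] (0 : ℝ), Function.Bijective (P + t • Q : E →L[ℝ] F) := by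
    have h1 : ∀ᶠ t in 𝓝[≠] (0 : ℝ), t ∉ {t : ℝ | A.charpoly.IsRoot t} := by
      have h3 := (hroots.sdiff (t := {0})).isClosed.isOpen_compl.mem_nhds
        (show (0 : ℝ) ∈ ({t : ℝ | A.charpoly.IsRoot t} \ {0})ᶜ by simp)
      filter_upwards [nhdsWithin_le_nhds h3, self_mem_nhdsWithin] with t ht ht0 hr
      exact ht ⟨hr, ht0⟩
    exact h1.mono fun t ht => hne t ht
  exact hev.frequently.filter_mono nhdsWithin_le_nhds

theorem dense_hasInvertibleMixedHessian [T2Space M] [T2Space N] [Nonempty M] [Nonempty N] :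
    @Dense _ (ckTopology ((𝓡 n).prod (𝓡 n)) (M × N) 2)
      {c | HasInvertibleMixedHessian n (c : M × N → ℝ)} := by
  let _ : TopologicalSpace _ := ckTopology ((𝓡 n).prod (𝓡 n)) (M × N) 2
  intro c
  obtain ⟨x⟩ := ‹Nonempty M›
  obtain ⟨y⟩ := ‹Nonempty N›
  obtain ⟨φ, hφ⟩ := exists_mixedHessian_eq_innerSL (n := n) x y
  have hb : Function.Bijective (mixedHessian n (φ : M × N → ℝ) x y) := by
    rw [show (mixedHessian n (φ : M × N → ℝ) x y : _ → _) = _ from funext hφ]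
    exact (InnerProductSpace.toDual ℝ (EuclideanSpace ℝ (Fin n))).bijective
  refine mem_closure_of_frequently_of_tendsto ?_ (tendsto_add_smul_ckTopology c φ)
  refine (frequently_bijective_add_smul (mixedHessian n (c : M × N → ℝ) x y) _ hb).mono
    fun t ht => ⟨x, y, ?_⟩
  rw [mixedHessian_add_smul]
  exact ht

end MixedHessianOpenDense

/-! ### Non-genericity of the twist condition -/

theorem theorem1p1 (n : ℕ) (hn : 1 ≤ n) (M N : Type*)
    [TopologicalSpace M] [T2Space M] [CompactSpace M] [Nonempty M]
    [ChartedSpace (EuclideanSpace ℝ (Fin n)) M] [IsManifold (𝓡 n) ∞ M]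
    [MeasurableSpace M] [BorelSpace M]
    [TopologicalSpace N] [T2Space N] [CompactSpace N] [Nonempty N]
    [ChartedSpace (EuclideanSpace ℝ (Fin n)) N] [IsManifold (𝓡 n) ∞ N]
    [MeasurableSpace N] [BorelSpace N] :
    (∀ c : M × N → ℝ, ContMDiff ((𝓡 n).prod (𝓡 n)) 𝓘(ℝ, ℝ) 2 c →
      HasInvertibleMixedHessian n c →
      ∃ (μ : Measure M) (ν : Measure N),
        IsProbabilityMeasure μ ∧ IsProbabilityMeasure ν ∧
        IsLebesgueAC n μ ∧ IsLebesgueAC n ν ∧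
        (∃ γ : Measure (M × N), IsOptimalPlan c μ ν γ ∧
          (∀ γ' : Measure (M × N), IsOptimalPlan c μ ν γ' → γ' = γ) ∧
          ¬ IsSupportedOnGraph γ) ∧
        ¬ ∃ T : M → N, IsMongeSolution c μ ν T) ∧
    IsOpen[ckTopology ((𝓡 n).prod (𝓡 n)) (M × N) 2]
      {c | HasInvertibleMixedHessian n (c : M × N → ℝ)} ∧
    @Dense _ (ckTopology ((𝓡 n).prod (𝓡 n)) (M × N) 2)
      {c | HasInvertibleMixedHessian n (c : M × N → ℝ)} :=
  ⟨fun _ hc hinv => exists_nonGraph_optimalPlan hn hc hinv, isOpen_hasInvertibleMixedHessian,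
    dense_hasInvertibleMixedHessian⟩
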